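/- **Conventions.** Let $(M,J)$ be a (Hausdorff) complex manifold of complex dimension $n$ and $\nabla$ a smooth flat torsionfree connection on its real tangent bundle. A *local holomorphic $\mathbb C^*$-action* on $M$ is a holomorphic map $(\lambda,p)\mapsto\varphi_\lambda(p)\in M$ defined on an open neighbourhood $W\subset\mathbb C^*\times M$ of $\{1\}\times M$ such that $\varphi_1(p)=p$, and $\varphi_\lambda(\varphi_\mu(p))=\varphi_{\lambda\mu}(p)$ whenever $(\mu,p),(\lambda,\varphi_\mu(p)),(\lambda\mu,p)\in W$. Equations involving $\varphi_\lambda$ are meant locally: near each point of the domain of the objects involved, and for $\lambda$ near $1$. Such an action is called *conic* for $(M,J,\nabla)$ if locally $d\varphi_\lambda X=r(\cos\theta)X+r(\sin\theta)JX$ for all local $\nabla$-parallel vector fields $X$, where $\lambda=re^{i\theta}$. $(M,J,\nabla)$ is a *conic complex manifold* if it admits a conic local holomorphic $\mathbb C^*$-action. A *conic symplectic manifold* $(M,J,\nabla,\omega)$ is a conic complex manifold with a $\nabla$-parallel symplectic form $\omega$; it is *conic Kähler* if moreover $\omega$ is $J$-invariant. A function $f$ is *affine* if $\nabla df=0$;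 local coordinates are affine if they are affine functions. Affine local coordinates $(x^1,\dots,x^n,y_1,\dots,y_n)$ are *real special coordinates* if $\omega=2\sum_i dx^i\wedge dy_i$. A *conjugate pair of special coordinates* is a pair of holomorphic local coordinate systems $(z^1,\dots,z^n)$ and $(w_1,\dots,w_n)$ such that $(\operatorname{Re}z^1,\dots,\operatorname{Re}z^n,\operatorname{Re}w_1,\dots,\operatorname{Re}w_n)$ are real special coordinates. For a local holomorphic $\mathbb C^*$-action $\varphi_\lambda$, a point $p\in M$, and holomorphic functions $z^1,\dots,z^n,w_1,\dots,w_n$ defined near $p$, consider the conditions (a) $z^i\circ\varphi_\lambda=\lambda z^i$ and $w_j\circ\varphi_\lambda=\lambda w_j$ near $p$, for all $i$ and $j$; (b) $x^1:=\operatorname{Re}z^1,\dots,x^n:=\operatorname{Re}z^n,\ y_1:=\operatorname{Re}w_1,\dots,y_n:=\operatorname{Re}w_n$ are affine local coordinates near $p$. **Theorem.** (i) $(M,J,\nabla)$ is a conic complex manifold if and only if there exists a local holomorphic $\mathbb C^*$-action $\varphi_\lambda$ and, for every $p\in M$, holomorphic functions $z^1,\dots,z^n,w_1,\dots,w_n$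 defined near $p$ that satisfy (a) and (b). (ii) Let $\omega$ be a $\nabla$-parallel symplectic form on $M$. Then $(M,J,\nabla,\omega)$ is a conic symplectic manifold if and only if there exists a local holomorphic $\mathbb C^*$-action $\varphi_\lambda$ and, for every $p\in M$, holomorphic functions $z^1,\dots,z^n,w_1,\dots,w_n$ defined near $p$ that satisfy (a) and (b). Moreover, if $(M,J,\nabla,\omega)$ is conic symplectic and $\varphi_\lambda$ is any conic local holomorphic $\mathbb C^*$-action on it, then near every $p\in M$ the functions $z^i,w_j$ satisfying (a) and (b) can be chosen such that $(x^1,\dots,x^n,y_1,\dots,y_n)$ is a real special coordinate system. (iii) Let $\omega$ be a $\nabla$-parallel $J$-invariant symplectic form on $M$. Then $(M,J,\nabla,\omega)$ is a conic Kähler manifold if and only if there exists a local holomorphic $\mathbb C^*$-action $\varphi_\lambda$ and, for every $p\in M$, holomorphic functions $z^1,\dots,z^n,w_1,\dots,w_n$ defined near $p$ that satisfy (a) and (b). Moreover, if $(M,J,\nabla,\omega)$ is conic Kähler and $\varphi_\lambda$ is any conic local holomorphic $\mathbb C^*$-action on it, then near every $p\in M$ the functions $z^i,w_j$ satisfying (a)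 and (b) can be chosen such that they form a conjugate pair of special coordinates. -/

import Mathlib

open scoped Manifold ContDiff Topology

/-!
Throughout, a complex manifold is a manifold `M` modelled on a finite-dimensional complex vector
space `E` with complex analytic transition functions (`IsManifold 𝓘(ℂ, E) ω M`). Its underlying
real manifold is the same charted space, with the model `𝓘(ℝ, E)`, and its real tangent bundle is
`TangentSpace 𝓘(ℝ, E)`. Its complex dimension is `n = Module.finrank ℂ E`.
-/

noncomputable section

namespace SpecialGeometry

section Basic

/-- A finite-dimensional complex normed space is complete. -/
instance completeSpace_of_finiteDimensional_complex {E : Type*} [NormedAddCommGroup E]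
    [NormedSpace ℂ E] [FiniteDimensional ℂ E] : CompleteSpace E :=
  FiniteDimensional.complete ℂ E

/-- The real analytic manifold underlying a complex manifold. -/
instance isManifold_real {E : Type*} [NormedAddCommGroup E] [NormedSpace ℂ E]
    {M : Type*} [TopologicalSpace M] [ChartedSpace E M] [h : IsManifold 𝓘(ℂ, E) ω M] :
    IsManifold 𝓘(ℝ, E) ω M := by
  refine isManifold_of_contDiffOn 𝓘(ℝ, E) ω M fun e e' he he' => ?_
  have hc := ((contDiffGroupoid ω 𝓘(ℂ, E)).compatible he he')
  rw [contDiffGroupoid, mem_groupoid_of_pregroupoid] at hc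
  exact (ContDiffOn.restrict_scalars ℝ hc.1 :)

end Basic

section Defs

variable {E : Type*} [NormedAddCommGroup E] [NormedSpace ℂ E] [FiniteDimensional ℂ E]
  {M : Type*} [TopologicalSpace M] [ChartedSpace E M] [IsManifold 𝓘(ℂ, E) ω M]

variable (E M) in
/-- A connection on the real tangent bundle of `M`; `∇ Y x v` is `∇_v Y` for `v ∈ T_x M`. -/
abbrev Connection : Type _ :=
  CovariantDerivative 𝓘(ℝ, E) E (TangentSpace 𝓘(ℝ, E) : M → Type _)

/-- The complex structure `J` on `T_x M`. The tangent space at `x` is identified with `E` by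
means of the holomorphic chart at `x`, and `J` is multiplication by the imaginary unit there. -/
def J (x : M) : TangentSpace 𝓘(ℝ, E) x →L[ℝ] TangentSpace 𝓘(ℝ, E) x :=
  (Complex.I • ContinuousLinearMap.id ℝ E : E →L[ℝ] E)

/-- The vector field `X` (on the real tangent bundle) is smooth on `U`. -/
def SmoothFieldOn (X : Π x : M, TangentSpace 𝓘(ℝ, E) x) (U : Set M) : Prop :=
  ContMDiffOn 𝓘(ℝ, E) 𝓘(ℝ, E).tangent ∞ (fun x => (⟨x, X x⟩ : TangentBundle 𝓘(ℝ, E) M)) U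

/-- The real differential `df` at `x` of a function with values in a real normed space. -/
def dR {F : Type*} [NormedAddCommGroup F] [NormedSpace ℝ F] (f : M → F) (x : M) :
    TangentSpace 𝓘(ℝ, E) x →L[ℝ] F :=
  mvfderiv 𝓘(ℝ, E) f x

/-- The curvature `∇_X ∇_Y Z - ∇_Y ∇_X Z - ∇_[X,Y] Z` vanishes for all local vector fields. -/
def IsFlat (D : Connection E M) : Prop :=
  ∀ (U : Set M) (X Y Z : Π x : M, TangentSpace 𝓘(ℝ, E) x), IsOpen U →
    SmoothFieldOn X U → SmoothFieldOn Y U → SmoothFieldOn Z U → ∀ x ∈ U,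
      D (fun y => D Z y (Y y)) x (X x) - D (fun y => D Z y (X y)) x (Y x)
        - D Z x (VectorField.mlieBracket 𝓘(ℝ, E) X Y x) = 0

/-- The vector field `X` is a smooth `∇`-parallel vector field on `U`. -/
def IsParallelFieldOn (D : Connection E M) (X : Π x : M, TangentSpace 𝓘(ℝ, E) x)
    (U : Set M) : Prop :=
  SmoothFieldOn X U ∧ ∀ x ∈ U, D X x = 0

/-- The function `f` is smooth on `U` and `∇ df = 0` on `U`, that is
`(∇_v df)(Y) = v (df(Y)) - df(∇_v Y)` vanishes for all vectors `v` and vector fields `Y`. -/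
def IsAffineOn (D : Connection E M) (f : M → ℝ) (U : Set M) : Prop :=
  ContMDiffOn 𝓘(ℝ, E) 𝓘(ℝ, ℝ) ∞ f U ∧
    ∀ Y : Π x : M, TangentSpace 𝓘(ℝ, E) x, SmoothFieldOn Y U →
      ∀ x ∈ U, ∀ v : TangentSpace 𝓘(ℝ, E) x,
        dR (fun y => dR f y (Y y)) x v - dR f x (D Y x v) = 0

/-- A local holomorphic `ℂ*`-action on `M`: a holomorphic map `(c, p) ↦ φ_c(p)` that is defined on
an open neighbourhood `domain` of `{1} × M` in `ℂ* × M`. -/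
structure LocalAction (E : Type*) [NormedAddCommGroup E] [NormedSpace ℂ E]
    (M : Type*) [TopologicalSpace M] [ChartedSpace E M] where
  domain : Set (ℂ × M)
  act : ℂ → M → M
  isOpen_domain : IsOpen domain
  ne_zero : ∀ (c : ℂ) (p : M), (c, p) ∈ domain → c ≠ 0
  one_mem : ∀ p : M, ((1 : ℂ), p) ∈ domain
  holomorphic : ContMDiffOn (𝓘(ℂ, ℂ).prod 𝓘(ℂ, E)) 𝓘(ℂ, E) ω
    (fun x : ℂ × M => act x.1 x.2) domain
  one_act : ∀ p : M, act 1 p = p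
  mul_act : ∀ (a b : ℂ) (p : M), (b, p) ∈ domain → (a, act b p) ∈ domain → (a * b, p) ∈ domain →
    act a (act b p) = act (a * b) p

/-- Locally `dφ_c X = r e^{θJ} X = r cos θ X + r sin θ JX`, `c = r e^{iθ}`, for all `∇`-parallel
vector fields `X`: for every parallel vector field `X` on an open set `U` and every `p ∈ U` the
equation holds at all points near `p`, for all `c` near `1`. -/
def LocalAction.IsConic (φ : LocalAction E M) (D : Connection E M) : Prop :=
  ∀ (U : Set M) (X : Π x : M, TangentSpace 𝓘(ℝ, E) x), IsOpen U → IsParallelFieldOn D X U →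
    ∀ p ∈ U, ∀ᶠ cq : ℂ × M in 𝓝 ((1 : ℂ), p),
      mfderiv 𝓘(ℝ, E) 𝓘(ℝ, E) (φ.act cq.1) cq.2 (X cq.2) =
        (‖cq.1‖ * Real.cos cq.1.arg) • X (φ.act cq.1 cq.2)
          + (‖cq.1‖ * Real.sin cq.1.arg) • J (φ.act cq.1 cq.2) (X (φ.act cq.1 cq.2))

/-- `(M, J, ∇)`, with `∇` flat and torsionfree, is a conic complex manifold. -/
def IsConicComplex (D : Connection E M) : Prop :=
  ∃ φ : LocalAction E M, φ.IsConic D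

variable (E M) in
/-- A field of real bilinear forms on `M`. -/
abbrev BilinField : Type _ :=
  Π x : M, TangentSpace 𝓘(ℝ, E) x →L[ℝ] TangentSpace 𝓘(ℝ, E) x →L[ℝ] ℝ

/-- `α` is a symplectic form: a smooth, alternating, nondegenerate and closed two-form. -/
structure IsSymplectic (α : BilinField E M) : Prop where
  smooth : ContMDiff 𝓘(ℝ, E) (𝓘(ℝ, E).prod 𝓘(ℝ, E →L[ℝ] E →L[ℝ] ℝ)) ∞
    (fun x => Bundle.TotalSpace.mk' (E →L[ℝ] E →L[ℝ] ℝ)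
      (E := fun x : M => TangentSpace 𝓘(ℝ, E) x →L[ℝ] TangentSpace 𝓘(ℝ, E) x →L[ℝ] ℝ) x (α x))
  alternating : ∀ (x : M) (v : TangentSpace 𝓘(ℝ, E) x), α x v v = 0
  nondegenerate : ∀ (x : M) (v : TangentSpace 𝓘(ℝ, E) x), (∀ w, α x v w = 0) → v = 0
  closed : ∀ (U : Set M) (X Y Z : Π x : M, TangentSpace 𝓘(ℝ, E) x), IsOpen U →
    SmoothFieldOn X U → SmoothFieldOn Y U → SmoothFieldOn Z U → ∀ x ∈ U,
      dR (fun y => α y (Y y) (Z y)) x (X x) + dR (fun y => α y (Z y) (X y)) x (Y x)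
        + dR (fun y => α y (X y) (Y y)) x (Z x)
        - α x (VectorField.mlieBracket 𝓘(ℝ, E) X Y x) (Z x)
        - α x (VectorField.mlieBracket 𝓘(ℝ, E) Y Z x) (X x)
        - α x (VectorField.mlieBracket 𝓘(ℝ, E) Z X x) (Y x) = 0

/-- `∇ α = 0`, where `(∇_v α)(Y, Z) = v (α(Y, Z)) - α(∇_v Y, Z) - α(Y, ∇_v Z)`. -/
def IsParallelForm (D : Connection E M) (α : BilinField E M) : Prop :=
  ∀ (U : Set M) (Y Z : Π x : M, TangentSpace 𝓘(ℝ, E) x), IsOpen U →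
    SmoothFieldOn Y U → SmoothFieldOn Z U → ∀ x ∈ U, ∀ v : TangentSpace 𝓘(ℝ, E) x,
      dR (fun y => α y (Y y) (Z y)) x v - α x (D Y x v) (Z x) - α x (Y x) (D Z x v) = 0

/-- `α(JX, JY) = α(X, Y)`. -/
def IsJInvariant (α : BilinField E M) : Prop :=
  ∀ (x : M) (v w : TangentSpace 𝓘(ℝ, E) x), α x (J x v) (J x w) = α x v w

/-- A conic symplectic manifold: a conic complex manifold with a parallel symplectic form. -/
def IsConicSymplectic (D : Connection E M) (α : BilinField E M) : Prop :=
  IsConicComplex D ∧ IsSymplectic α ∧ IsParallelForm D α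

/-- A conic Kähler manifold: a conic symplectic manifold whose symplectic form is
`J`-invariant. -/
def IsConicKaehler (D : Connection E M) (α : BilinField E M) : Prop :=
  IsConicSymplectic D α ∧ IsJInvariant α

/-- The function `f` is defined and holomorphic (that is, complex differentiable) near `p`. -/
def HolomorphicNear (f : M → ℂ) (p : M) : Prop :=
  ∀ᶠ q in 𝓝 p, MDifferentiableAt 𝓘(ℂ, E) 𝓘(ℂ, ℂ) f q

/-- The equation `f ∘ φ_c = c f` holds near `p`, for all `c` near `1`. -/
def HomogeneousNear (φ : LocalAction E M) (f : M → ℂ) (p : M) : Prop :=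
  ∀ᶠ cq : ℂ × M in 𝓝 ((1 : ℂ), p), f (φ.act cq.1 cq.2) = cq.1 * f cq.2

variable {n : ℕ}

/-- The functions `x¹, …, xⁿ, y₁, …, yₙ` are local coordinates near `p` (they define a
diffeomorphism from a neighbourhood of `p` onto an open subset of `ℝ²ⁿ`), and they are affine
functions near `p`. -/
def AreAffineCoordinatesNear (D : Connection E M) (x y : Fin n → M → ℝ) (p : M) : Prop :=
  IsLocalDiffeomorphAt 𝓘(ℝ, E) 𝓘(ℝ, (Fin n → ℝ) × (Fin n → ℝ)) ∞
      (fun q : M => ((fun i => x i q, fun j => y j q) : (Fin n → ℝ) × (Fin n → ℝ))) p ∧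
    ∃ U : Set M, IsOpen U ∧ p ∈ U ∧ (∀ i, IsAffineOn D (x i) U) ∧ ∀ j, IsAffineOn D (y j) U

/-- The functions `x¹, …, xⁿ, y₁, …, yₙ` form a real special coordinate system near `p`: an affine
local coordinate system with `α = 2 ∑ dxⁱ ∧ dyᵢ`. -/
def AreRealSpecialNear (D : Connection E M) (α : BilinField E M) (x y : Fin n → M → ℝ)
    (p : M) : Prop :=
  AreAffineCoordinatesNear D x y p ∧
    ∀ᶠ q in 𝓝 p, ∀ u v : TangentSpace 𝓘(ℝ, E) q,
      α q u v = 2 * ∑ i, (dR (x i) q u * dR (y i) q v - dR (x i) q v * dR (y i) q u)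

/-- The functions `z¹, …, zⁿ` are holomorphic local coordinates near `p`: they define a map from
a neighbourhood of `p` onto an open subset of `ℂⁿ` that is holomorphic (that is, of class `C¹`
over `ℂ`) and has a holomorphic inverse. -/
def AreHolomorphicCoordinatesNear (z : Fin n → M → ℂ) (p : M) : Prop :=
  IsLocalDiffeomorphAt 𝓘(ℂ, E) 𝓘(ℂ, Fin n → ℂ) 1 (fun q : M => fun i => z i q) p

/-- The real part of a family of complex-valued functions. -/
def rePart (z : Fin n → M → ℂ) : Fin n → M → ℝ := fun i q => (z i q).re

/-- The functions `z¹, …, zⁿ` and `w₁, …, wₙ` form a conjugate pair of special coordinates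
near `p`. -/
def AreConjugatePairNear (D : Connection E M) (α : BilinField E M) (z w : Fin n → M → ℂ)
    (p : M) : Prop :=
  AreHolomorphicCoordinatesNear (E := E) z p ∧ AreHolomorphicCoordinatesNear (E := E) w p ∧
    AreRealSpecialNear D α (rePart z) (rePart w) p

/-- The functions `z¹, …, zⁿ, w₁, …, wₙ` are holomorphic near `p`,
(a) `zⁱ ∘ φ_c = c zⁱ` and `wⱼ ∘ φ_c = c wⱼ` near `p`, and
(b) their real parts are affine local coordinates near `p`. -/
structure AreConicFunctionsNear (D : Connection E M) (φ : LocalAction E M) (z w : Fin n → M → ℂ)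
    (p : M) : Prop where
  holomorphic_z : ∀ i, HolomorphicNear (E := E) (z i) p
  holomorphic_w : ∀ j, HolomorphicNear (E := E) (w j) p
  homogeneous_z : ∀ i, HomogeneousNear φ (z i) p
  homogeneous_w : ∀ j, HomogeneousNear φ (w j) p
  affine : AreAffineCoordinatesNear D (rePart z) (rePart w) p

end Defs

end SpecialGeometry

end

open SpecialGeometry

/-! Let ξ be the generating vector field of a conic action. Differentiating dφ_λ X = λX for parallel
X (with λ acting through J) at λ = 1, and using that second derivatives commute and that ∇ is
torsionfree, gives ∇ξ = id and ∇(Jξ) = J (`IsConicModel.hasFDerivAt_coframe_generator`). For a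
parallel covector field T put F = T(ξ) - iT(Jξ). Then dF = T - iT∘J. This is complex linear, so F is
holomorphic; its real part T is parallel, so Re F is affine. Moreover dF(ξ) = F, which is Euler's
equation and integrates along orbits to F∘φ_λ = λF (`IsConicModel.potential_act`). The additive
constant of F is thus fixed by the formula. Letting T run through a parallel coframe gives the
functions z and w.

The only freedom is the linear isomorphism from the tangent space at p to ℝⁿ × ℝⁿ that selects the
covectors. A parallel form has constant coefficients in a parallel frame
(`IsParallelForm.eventually_eq_modelForm`), so special coordinates are a matter of linear algebra at
p: a symplectic basis eᵢ, fᵢ in the symplectic case, and one with fᵢ = εᵢJeᵢ in the Kähler case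
(`exists_hermitian_coordinates`). In the latter J interchanges the spans of the eᵢ and of the fᵢ, so
z alone and w alone are complex coordinates.

Local parallel frames come from flatness: `exists_fundamental_solution_of_flat` solves dg = -Γg by
integrating along rays, and flatness makes the radial solution solve the full system.

For the converse, let A and A' be the differentials of the affine coordinates at q and at φ_λ(q).
Homogeneity gives dφ_λ = aY + bYJ with Y = A'⁻¹A and λ = a + ib. Since dφ_λ commutes with J, so does
Y (`eq_smul_add_smul_of_commute`); and Y carries parallel fields to themselves, because affine
functions have constant derivative along them. This is the conic equation. -/

namespace SpecialGeometry

/-! ### Flat linear systems dg = -Ag in a Banach algebra -/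

section FlatSystem

variable {E : Type*} [NormedAddCommGroup E] [NormedSpace ℝ E]
  {𝔸 : Type*} [NormedRing 𝔸] [NormedAlgebra ℝ 𝔸]

/-- A linear ordinary differential equation with small coefficients is solvable on `[0, 1]`. -/
theorem exists_linear_ode_solution [CompleteSpace 𝔸] {B : ℝ → 𝔸}
    (hB : ContinuousOn B (Set.Icc 0 1)) (hB' : ∀ t ∈ Set.Icc (0 : ℝ) 1, ‖B t‖ ≤ 1 / 2) :
    ∃ γ : ℝ → 𝔸, γ 0 = 1 ∧
      ∀ t ∈ Set.Icc (0 : ℝ) 1, HasDerivWithinAt γ (-(B t * γ t)) (Set.Icc 0 1) t := by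
  have h0 : (0 : ℝ) ∈ Set.Icc (0 : ℝ) 1 := by simp
  -- In the ball of radius ‖1‖ around 1 one has ‖y‖ ≤ 2‖1‖, so the bound 1/2 on B limits the speed
  -- to ‖1‖ and the solution cannot leave the ball before time 1.
  have hP : IsPicardLindelof (fun t y => -(B t * y)) (tmin := 0) (tmax := 1) ⟨0, h0⟩ (1 : 𝔸)
      ‖(1 : 𝔸)‖₊ 0 ‖(1 : 𝔸)‖₊ 1 := by
    refine ⟨fun t ht => ?_, fun y _ => (hB.mul continuousOn_const).neg, fun t ht y hy => ?_, ?_⟩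
    · refine LipschitzOnWith.of_dist_le_mul fun y _ z _ => ?_
      rw [dist_neg_neg, dist_eq_norm, dist_eq_norm, ← mul_sub]
      refine (norm_mul_le _ _).trans ?_
      have := hB' t ht
      gcongr
      simpa using this.trans (by norm_num)
    · have h1 : ‖y‖ ≤ 2 * ‖(1 : 𝔸)‖ := by
        have h2 : ‖y - 1‖ ≤ ‖(1 : 𝔸)‖ := by simpa [dist_eq_norm] using hy
        have h3 := norm_add_le (y - 1) 1
        rw [sub_add_cancel] at h3
        linarith
      rw [norm_neg]
      calc ‖B t * y‖ ≤ ‖B t‖ * ‖y‖ := norm_mul_le _ _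
        _ ≤ 1 / 2 * (2 * ‖(1 : 𝔸)‖) := by
          have := hB' t ht
          gcongr
        _ = _ := by simp
    · simp
  exact hP.exists_eq_forall_mem_Icc_hasDerivWithinAt₀

/-- A first order Taylor estimate for a map whose derivative is Lipschitz. -/
theorem norm_taylor_le {F G : Type*} [NormedAddCommGroup F] [NormedSpace ℝ F]
    [NormedAddCommGroup G] [NormedSpace ℝ G] {f : F → G} {s : Set F} {K : NNReal}
    (hs : Convex ℝ s) (hf : ∀ x ∈ s, DifferentiableAt ℝ f x)
    (hK : LipschitzOnWith K (fderiv ℝ f) s) {x y : F} (hx : x ∈ s) (hy : y ∈ s) :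
    ‖f y - f x - fderiv ℝ f x (y - x)‖ ≤ K * ‖y - x‖ * ‖y - x‖ := by
  have hseg : segment ℝ x y ⊆ s := hs.segment_subset hx hy
  refine (convex_segment x y).norm_image_sub_le_of_norm_fderiv_le' (fun z hz => hf z (hseg hz))
    (fun z hz => ?_) (left_mem_segment ℝ x y) (right_mem_segment ℝ x y)
  rw [← dist_eq_norm]
  refine (hK.dist_le_mul _ (hseg hz) _ hx).trans ?_
  gcongr
  rw [dist_eq_norm]
  obtain ⟨a, b, ha, hb, hab, rfl⟩ := hz
  have : a • x + b • y - x = b • (y - x) := by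
    rw [← eq_sub_iff_add_eq] at hab
    subst hab
    module
  rw [this, norm_smul, Real.norm_of_nonneg hb]
  exact mul_le_of_le_one_left (norm_nonneg _) (by linarith)

omit [NormedAlgebra ℝ 𝔸] in
/-- The algebraic identity behind the variation of the radial solutions of a flat system. -/
theorem flat_variation_identity (a a' y y' θ θ' D' : 𝔸) (hD : θ' = D' - (a * θ - θ * a)) :
    -(a' * y') + a * y + (θ' * y - θ * (a * y))
      = -(a' * (y' - y + θ * y)) + (a' - a) * θ * y - (a' - a - D') * y := by
  subst hD
  noncomm_ring

/-- The value g(x) is the endpoint at t = 1 of the solution γ_x of γ' = -A(tx)(x)γ with γ(0) = 1.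
For y = x + h, the candidate first variation is -θγ_x with θ(t) = A(tx)(th). Flatness implies that
the error γ_y - γ_x + θγ_x satisfies a linear equation with zero initial value and an inhomogeneity
of order ‖h‖². Grönwall's inequality then bounds the error by a multiple of ‖h‖², which gives dg =
-Ag at x. -/
theorem exists_hasFDerivAt_of_flat_zero [CompleteSpace 𝔸] {A : E → E →L[ℝ] 𝔸}
    (hA : ContDiffAt ℝ 2 A 0)
    (hflat : ∀ᶠ x in 𝓝 (0 : E), ∀ u v, fderiv ℝ A x u v - fderiv ℝ A x v u
      + (A x u * A x v - A x v * A x u) = 0) :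
    ∃ r > 0, ∃ g : E → 𝔸, g 0 = 1 ∧ ∀ x ∈ Metric.ball (0 : E) r,
      HasFDerivAt g (-((ContinuousLinearMap.mul ℝ 𝔸).flip (g x) ∘L A x)) x := by
  obtain ⟨K, s, hs, hK⟩ := ContDiffAt.exists_lipschitzOnWith
    (hA.fderiv_right (m := 1) (by norm_num))
  obtain ⟨K₀, s₀, hs₀, hK₀⟩ := ContDiffAt.exists_lipschitzOnWith (hA.of_le
    (by norm_num : (1 : WithTop ℕ∞) ≤ 2))
  have hdiff : ∀ᶠ x in 𝓝 (0 : E), DifferentiableAt ℝ A x := by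
    filter_upwards [hA.eventually (by simp)] with x hx using hx.differentiableAt (by norm_num)
  set C := ‖A 0‖ + 1 with hC
  have hbd : ∀ᶠ x in 𝓝 (0 : E), ‖A x‖ ≤ C := by
    have := hA.continuousAt.norm.eventually (gt_mem_nhds (show ‖A 0‖ < C by simp [hC]))
    filter_upwards [this] with x hx using hx.le
  obtain ⟨r₀, hr₀, hball⟩ := Metric.eventually_nhds_iff_ball.1
    (hflat.and (hdiff.and (hbd.and (Filter.Eventually.and (p := (· ∈ s)) (q := (· ∈ s₀)) hs hs₀))))
  have hCpos : 0 < C := by positivity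
  -- The second bound makes ‖A(tx)x‖ ≤ 1/2, as the existence lemma for the radial equation requires.
  set r := min r₀ (1 / (2 * C)) with hr
  have hrpos : 0 < r := by positivity
  set b := Metric.ball (0 : E) r with hb
  have hbconv : Convex ℝ b := convex_ball _ _
  have hbr : ∀ x ∈ b, x ∈ Metric.ball (0 : E) r₀ := fun x hx =>
    Metric.ball_subset_ball (min_le_left _ _) hx
  have hKb : LipschitzOnWith K (fderiv ℝ A) b := hK.mono fun x hx => (hball x (hbr x hx)).2.2.2.1
  have hK₀b : LipschitzOnWith K₀ A b := hK₀.mono fun x hx => (hball x (hbr x hx)).2.2.2.2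
  have hmem : ∀ x ∈ b, ∀ t ∈ Set.Icc (0 : ℝ) 1, t • x ∈ b := fun x hx t ht =>
    hbconv.smul_mem_of_zero_mem (Metric.mem_ball_self hrpos) hx ht
  have hdA : ∀ x ∈ b, DifferentiableAt ℝ A x := fun x hx => (hball x (hbr x hx)).2.1
  have hCA : ∀ x ∈ b, ‖A x‖ ≤ C := fun x hx => (hball x (hbr x hx)).2.2.1
  have hnorm : ∀ x ∈ b, ‖x‖ < r := fun x hx => by simpa [hb] using hx
  have hhalf : ∀ x ∈ b, ∀ t ∈ Set.Icc (0 : ℝ) 1, ‖A (t • x) x‖ ≤ 1 / 2 := by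
    intro x hx t ht
    calc ‖A (t • x) x‖ ≤ ‖A (t • x)‖ * ‖x‖ := (A (t • x)).le_opNorm x
      _ ≤ C * (1 / (2 * C)) := by
        have h1 := hCA _ (hmem x hx t ht)
        have h2 := (hnorm x hx).le.trans (min_le_right r₀ (1 / (2 * C)))
        gcongr
      _ = 1 / 2 := by field_simp
  have hderA : ∀ x ∈ b, ∀ t ∈ Set.Icc (0 : ℝ) 1,
      HasDerivAt (fun t : ℝ => A (t • x)) (fderiv ℝ A (t • x) x) t := by
    intro x hx t ht
    have h1 : HasDerivAt (fun t : ℝ => t • x) x t := by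
      simpa using (hasDerivAt_id t).smul_const x
    exact (hdA _ (hmem x hx t ht)).hasFDerivAt.comp_hasDerivAt t h1
  have hsol : ∀ x ∈ b, ∃ γ : ℝ → 𝔸, γ 0 = 1 ∧ ∀ t ∈ Set.Icc (0 : ℝ) 1,
      HasDerivWithinAt γ (-(A (t • x) x * γ t)) (Set.Icc 0 1) t := by
    intro x hx
    refine exists_linear_ode_solution (B := fun t => A (t • x) x) (fun t ht => ?_) (hhalf x hx)
    exact ((hderA x hx t ht).continuousAt.clm_apply continuousAt_const).continuousWithinAt
  choose! γ hγ0 hγ using hsol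
  refine ⟨r, hrpos, fun x => γ x 1, ?_, fun x hx => ?_⟩
  · have h0 : (0 : E) ∈ b := Metric.mem_ball_self hrpos
    have hc : ∀ t ∈ Set.Icc (0 : ℝ) 1, γ 0 t = γ 0 0 := by
      refine constant_of_has_deriv_right_zero (fun t ht => (hγ 0 h0 t ht).continuousWithinAt)
        fun t ht => ?_
      have := hγ 0 h0 t ⟨ht.1, ht.2.le⟩
      simp only [map_zero, zero_mul, neg_zero] at this
      exact this.mono_of_mem_nhdsWithin (Icc_mem_nhdsGE_of_mem ht)
    exact (hc 1 (by simp)).trans (hγ0 0 h0)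
  obtain ⟨M, hM⟩ : ∃ M, ∀ t ∈ Set.Icc (0 : ℝ) 1, ‖γ x t‖ ≤ M :=
    isCompact_Icc.exists_bound_of_continuousOn fun t ht => (hγ x hx t ht).continuousWithinAt
  have hM0 : 0 ≤ M := (norm_nonneg _).trans (hM 0 (by simp))
  -- The first summand bounds the product of a' - a with θ, the second the second-order remainder of
  -- a, where a = A(tx)x and a' = A(ty)y; M bounds γ_x.
  set Q : ℝ := ((K₀ * r + C) * C + (K * r + K₀)) * M with hQ
  have hQ0 : 0 ≤ Q := by positivity
  have key : ∀ y ∈ b, ‖γ y 1 - γ x 1 + A x (y - x) * γ x 1‖ ≤ 2 * Q * (‖y - x‖ * ‖y - x‖) := by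
    intro y hy
    set h := y - x with hh
    set ε := Q * (‖h‖ * ‖h‖) with hε
    have hd : ∀ t ∈ Set.Icc (0 : ℝ) 1, HasDerivWithinAt
        (fun t => γ y t - γ x t + A (t • x) (t • h) * γ x t)
        (-(A (t • y) y * (γ y t - γ x t + A (t • x) (t • h) * γ x t))
          + (A (t • y) y - A (t • x) x) * A (t • x) (t • h) * γ x t
          - (A (t • y) y - A (t • x) x - (A (t • x) h + fderiv ℝ A (t • x) (t • h) x)) * γ x t)
        (Set.Icc 0 1) t := by
      intro t ht
      have h1 : HasDerivAt (fun t : ℝ => t • h) h t := by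
        simpa using (hasDerivAt_id t).smul_const h
      have h2 := (hderA x hx t ht).clm_apply h1
      have h3 := ((hγ y hy t ht).sub (hγ x hx t ht)).add (h2.hasDerivWithinAt.mul (hγ x hx t ht))
      have hfl := (hball _ (hbr _ (hmem x hx t ht))).1 x (t • h)
      convert! h3 using 1
      -- The derivative of θ contains dA(tx)(x)(th), whereas the first variation of A(tx)x contains
      -- dA(tx)(th)(x). Flatness at tx exchanges the two arguments at the cost of the commutator of
      -- A(tx)x and θ.
      rw [← flat_variation_identity (A (t • x) x) (A (t • y) y) (γ x t) (γ y t) (A (t • x) (t • h))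
        (fderiv ℝ A (t • x) x (t • h) + A (t • x) h) (A (t • x) h + fderiv ℝ A (t • x) (t • h) x)]
      · noncomm_ring
      · rw [← sub_eq_zero, ← hfl]
        abel
    have hbound : ∀ t ∈ Set.Ico (0 : ℝ) 1,
        ‖-(A (t • y) y * (γ y t - γ x t + A (t • x) (t • h) * γ x t))
          + (A (t • y) y - A (t • x) x) * A (t • x) (t • h) * γ x t
          - (A (t • y) y - A (t • x) x - (A (t • x) h + fderiv ℝ A (t • x) (t • h) x)) * γ x t‖
        ≤ 1 * ‖γ y t - γ x t + A (t • x) (t • h) * γ x t‖ + ε := by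
      intro t ht'
      have ht : t ∈ Set.Icc (0 : ℝ) 1 := ⟨ht'.1, ht'.2.le⟩
      have htx := hmem x hx t ht
      have hty := hmem y hy t ht
      have hth : t • y - t • x = t • h := by rw [hh, smul_sub]
      have hth' : ‖t • h‖ ≤ ‖h‖ := by
        rw [norm_smul, Real.norm_of_nonneg ht.1]
        exact mul_le_of_le_one_left (norm_nonneg _) ht.2
      have hL : ‖A (t • y) - A (t • x)‖ ≤ K₀ * ‖h‖ := by
        rw [← dist_eq_norm]
        refine (hK₀b.dist_le_mul _ hty _ htx).trans ?_
        rw [dist_eq_norm, hth]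
        gcongr
      have e1 : ‖A (t • y) y * (γ y t - γ x t + A (t • x) (t • h) * γ x t)‖
          ≤ 1 * ‖γ y t - γ x t + A (t • x) (t • h) * γ x t‖ := by
        refine (norm_mul_le _ _).trans ?_
        gcongr
        exact (hhalf y hy t ht).trans (by norm_num)
      have e2 : ‖A (t • y) y - A (t • x) x‖ ≤ (K₀ * r + C) * ‖h‖ := by
        have : A (t • y) y - A (t • x) x = (A (t • y) - A (t • x)) y + A (t • x) h := by
          simp [hh]
        rw [this]
        refine (norm_add_le _ _).trans ?_
        have a1 := (A (t • y) - A (t • x)).le_opNorm y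
        have a2 := (A (t • x)).le_opNorm h
        have a3 := hCA _ htx
        have a4 := (hnorm y hy).le
        have a5 : ‖A (t • y) - A (t • x)‖ * ‖y‖ ≤ K₀ * ‖h‖ * r := by gcongr
        have a6 : ‖A (t • x)‖ * ‖h‖ ≤ C * ‖h‖ := by gcongr
        linarith
      have e3 : ‖A (t • x) (t • h)‖ ≤ C * ‖h‖ := by
        refine ((A (t • x)).le_opNorm _).trans ?_
        have := hCA _ htx
        gcongr
      have e4 : ‖A (t • y) y - A (t • x) x - (A (t • x) h + fderiv ℝ A (t • x) (t • h) x)‖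
          ≤ (K * r + K₀) * (‖h‖ * ‖h‖) := by
        have : A (t • y) y - A (t • x) x - (A (t • x) h + fderiv ℝ A (t • x) (t • h) x)
            = (A (t • y) - A (t • x) - fderiv ℝ A (t • x) (t • y - t • x)) x
              + (A (t • y) - A (t • x)) h := by
          rw [hth]
          simp [hh]
          abel
        rw [this]
        refine (norm_add_le _ _).trans ?_
        have a1 := (A (t • y) - A (t • x) - fderiv ℝ A (t • x) (t • y - t • x)).le_opNorm x
        have a2 := (A (t • y) - A (t • x)).le_opNorm h
        have a3 := norm_taylor_le hbconv hdA hKb htx hty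
        rw [hth] at a3 a1
        have a4 := (hnorm x hx).le
        have a5 : ‖A (t • y) - A (t • x) - fderiv ℝ A (t • x) (t • h)‖ * ‖x‖
            ≤ K * ‖h‖ * ‖h‖ * r := by
          refine mul_le_mul (a3.trans ?_) a4 (norm_nonneg _) (by positivity)
          gcongr
        have a6 : ‖A (t • y) - A (t • x)‖ * ‖h‖ ≤ K₀ * ‖h‖ * ‖h‖ := by gcongr
        rw [hth]
        linarith
      have e5 := hM t ht
      have e6 : ‖(A (t • y) y - A (t • x) x) * A (t • x) (t • h) * γ x t‖
          ≤ (K₀ * r + C) * ‖h‖ * (C * ‖h‖) * M := by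
        refine (norm_mul_le _ _).trans (mul_le_mul ((norm_mul_le _ _).trans ?_) e5
          (norm_nonneg _) (by positivity))
        gcongr
      have e7 : ‖(A (t • y) y - A (t • x) x - (A (t • x) h + fderiv ℝ A (t • x) (t • h) x))
          * γ x t‖ ≤ (K * r + K₀) * (‖h‖ * ‖h‖) * M := by
        refine (norm_mul_le _ _).trans ?_
        gcongr
      refine (norm_sub_le _ _).trans ((add_le_add_left (norm_add_le _ _) _).trans ?_)
      rw [norm_neg]
      have e8 : ε = (K₀ * r + C) * ‖h‖ * (C * ‖h‖) * M + (K * r + K₀) * (‖h‖ * ‖h‖) * M := by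
        rw [hε, hQ]; ring
      linarith
    have hg := norm_le_gronwallBound_of_norm_deriv_right_le (δ := 0) (K := 1) (ε := ε)
      (fun t ht => (hd t ht).continuousWithinAt)
      (fun t ht => (hd t ⟨ht.1, ht.2.le⟩).mono_of_mem_nhdsWithin (Icc_mem_nhdsGE_of_mem ht))
      (by simp [hγ0 x hx, hγ0 y hy]) hbound 1 (by simp)
    rw [gronwallBound_of_K_ne_0 one_ne_zero] at hg
    simp only [one_smul] at hg
    refine hg.trans ?_
    -- With zero initial value and growth constant 1, Grönwall's bound at time 1 is ε(e - 1).
    have hexp : Real.exp 1 - 1 ≤ 2 := by linarith [Real.exp_one_lt_d9]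
    have hε0 : 0 ≤ ε := by positivity
    norm_num
    nlinarith
  rw [hasFDerivAt_iff_isLittleO]
  have hO : (fun y => γ y 1 - γ x 1
      - (-((ContinuousLinearMap.mul ℝ 𝔸).flip (γ x 1) ∘L A x)) (y - x)) =O[𝓝 x]
        fun y => ‖y - x‖ * ‖y - x‖ := by
    refine Asymptotics.IsBigO.of_bound (2 * Q) ?_
    filter_upwards [Metric.isOpen_ball.mem_nhds hx] with y hy
    have := key y hy
    rw [neg_apply, sub_neg_eq_add, Real.norm_of_nonneg (by positivity)]
    exact this
  refine hO.trans_isLittleO ?_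
  have h1 : (fun y : E => ‖y - x‖) =o[𝓝 x] fun _ => (1 : ℝ) := by
    rw [Asymptotics.isLittleO_one_iff]
    have : Filter.Tendsto (fun y : E => ‖y - x‖) (𝓝 x) (𝓝 ‖x - x‖) := by
      apply Continuous.tendsto; fun_prop
    simpa using this
  have h2 := h1.mul_isBigO (Asymptotics.isBigO_refl (fun y : E => ‖y - x‖) (𝓝 x))
  simpa using h2.norm_right

/-- A smooth flat linear system `dg = -A g` has a local fundamental solution. -/
theorem exists_fundamental_solution_of_flat [CompleteSpace 𝔸] {A : E → E →L[ℝ] 𝔸} {x₀ : E}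
    {s : Set E} (hs : IsOpen s) (hx₀ : x₀ ∈ s) (hA : ContDiffOn ℝ ∞ A s)
    (hflat : ∀ x ∈ s, ∀ u v, fderiv ℝ A x u v - fderiv ℝ A x v u
      + (A x u * A x v - A x v * A x u) = 0) :
    ∃ r > 0, Metric.ball x₀ r ⊆ s ∧ ∃ g : E → 𝔸, g x₀ = 1 ∧
      ContDiffOn ℝ ∞ g (Metric.ball x₀ r) ∧ ∀ x ∈ Metric.ball x₀ r,
        HasFDerivAt g (-((ContinuousLinearMap.mul ℝ 𝔸).flip (g x) ∘L A x)) x := by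
  have htr : Filter.Tendsto (fun y : E => x₀ + y) (𝓝 0) (𝓝 x₀) := by
    have : Continuous fun y : E => x₀ + y := by fun_prop
    simpa using this.tendsto 0
  have hle : (2 : WithTop ℕ∞) ≤ ∞ := WithTop.coe_le_coe.2 le_top
  have hA₀ : ContDiffAt ℝ 2 A (x₀ + 0) := by
    rw [add_zero]
    exact (hA.contDiffAt (hs.mem_nhds hx₀)).of_le hle
  obtain ⟨r₁, hr₁, g, hg0, hg⟩ := exists_hasFDerivAt_of_flat_zero
    (A := fun y => A (x₀ + y)) (ContDiffAt.comp (0 : E) hA₀ (by fun_prop))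
    (by
      filter_upwards [htr.eventually (hs.mem_nhds hx₀)] with y hy u v
      simpa only [fderiv_comp_add_left] using hflat _ hy u v)
  obtain ⟨r₂, hr₂, hA₂⟩ := Metric.isOpen_iff.1 hs x₀ hx₀
  have hsub : Metric.ball x₀ (min r₁ r₂) ⊆ s :=
    (Metric.ball_subset_ball (min_le_right _ _)).trans hA₂
  have hder : ∀ x ∈ Metric.ball x₀ (min r₁ r₂), HasFDerivAt (fun y => g (y - x₀))
      (-((ContinuousLinearMap.mul ℝ 𝔸).flip (g (x - x₀)) ∘L A x)) x := by
    intro x hx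
    have h1 : x - x₀ ∈ Metric.ball (0 : E) r₁ := by
      have := Metric.ball_subset_ball (min_le_left _ _) hx
      simpa [dist_eq_norm] using this
    have h2 := hg _ h1
    rw [add_sub_cancel] at h2
    have h3 := h2.comp x ((hasFDerivAt_id x).sub_const x₀)
    rw [ContinuousLinearMap.comp_id] at h3
    exact h3
  refine ⟨min r₁ r₂, lt_min hr₁ hr₂, hsub, fun y => g (y - x₀), by simpa using hg0, ?_, hder⟩
  rw [contDiffOn_infty]
  intro k
  -- Bootstrapping: the equation expresses dg through A and g, so g of class Cᵏ is of class Cᵏ⁺¹.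
  induction k with
  | zero =>
    exact contDiffOn_zero.2 fun x hx => (hder x hx).continuousAt.continuousWithinAt
  | succ k ih =>
    rw [Nat.cast_add, Nat.cast_one, contDiffOn_succ_iff_fderiv_of_isOpen Metric.isOpen_ball]
    refine ⟨fun x hx => (hder x hx).differentiableAt.differentiableWithinAt,
      fun h => absurd h (by simp), ?_⟩
    have hAk : ContDiffOn ℝ k A (Metric.ball x₀ (min r₁ r₂)) :=
      (hA.mono hsub).of_le (WithTop.coe_le_coe.2 le_top)
    have hc : ContDiffOn ℝ k (fun x => -((ContinuousLinearMap.mul ℝ 𝔸).flip (g (x - x₀)) ∘L A x))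
        (Metric.ball x₀ (min r₁ r₂)) :=
      (((ContinuousLinearMap.mul ℝ 𝔸).flip.contDiff.comp_contDiffOn ih).clm_comp hAk).neg
    exact hc.congr fun x hx => (hder x hx).fderiv

end FlatSystem

/-! ### Symplectic bases, also adapted to a complex structure -/

section LinearAlgebra

variable {V : Type*} [AddCommGroup V] [Module ℝ V]

/-- The vectors `eᵢ, fᵢ` satisfy the relations of a symplectic basis for the form `B / 2`. -/
structure IsSymplecticFamily (B : V →ₗ[ℝ] V →ₗ[ℝ] ℝ) {k : ℕ} (e f : Fin k → V) : Prop where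
  ee : ∀ i j, B (e i) (e j) = 0
  ff : ∀ i j, B (f i) (f j) = 0
  ef : ∀ i j, B (e i) (f j) = if i = j then 2 else 0

/-- A symplectic family of size `n` exists as soon as smaller ones can be extended. -/
theorem exists_isSymplecticFamily {B : V →ₗ[ℝ] V →ₗ[ℝ] ℝ} (hB : B.IsAlt) {n : ℕ}
    (P : V → V → Prop)
    (step : ∀ k < n, ∀ e f : Fin k → V, IsSymplecticFamily B e f → (∀ i, P (e i) (f i)) →
      ∃ u v, B u v = 2 ∧ P u v ∧
        ∀ i, B (e i) u = 0 ∧ B (f i) u = 0 ∧ B (e i) v = 0 ∧ B (f i) v = 0) :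
    ∃ e f : Fin n → V, IsSymplecticFamily B e f ∧ ∀ i, P (e i) (f i) := by
  suffices h : ∀ k ≤ n, ∃ e f : Fin k → V, IsSymplecticFamily B e f ∧ ∀ i, P (e i) (f i) from
    h n le_rfl
  intro k
  induction k with
  | zero =>
    exact fun _ => ⟨Fin.elim0, Fin.elim0, ⟨fun i => i.elim0, fun i => i.elim0, fun i => i.elim0⟩,
      fun i => i.elim0⟩
  | succ k ih =>
    intro hk
    obtain ⟨e, f, h, hP⟩ := ih (by omega)
    obtain ⟨u, v, huv, hPuv, horth⟩ := step k (by omega) e f h hP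
    have hneg : ∀ x y, B x y = 0 → B y x = 0 := fun x y hxy => by
      rw [← neg_eq_zero, hB.neg, hxy]
    refine ⟨Fin.snoc e u, Fin.snoc f v, ⟨?_, ?_, ?_⟩, ?_⟩
    · intro i j
      refine Fin.lastCases ?_ (fun i => ?_) i <;> refine Fin.lastCases ?_ (fun j => ?_) j
      · simpa using hB u
      · simpa using hneg _ _ (horth j).1
      · simpa using (horth i).1
      · simpa using h.ee i j
    · intro i j
      refine Fin.lastCases ?_ (fun i => ?_) i <;> refine Fin.lastCases ?_ (fun j => ?_) j
      · simpa using hB v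
      · simpa using hneg _ _ (horth j).2.2.2
      · simpa using (horth i).2.2.2
      · simpa using h.ff i j
    · intro i j
      refine Fin.lastCases ?_ (fun i => ?_) i <;> refine Fin.lastCases ?_ (fun j => ?_) j
      · simpa using huv
      · have : Fin.last k ≠ j.castSucc := (Fin.castSucc_lt_last j).ne'
        simpa [this] using hneg _ _ (horth j).2.1
      · have : i.castSucc ≠ Fin.last k := (Fin.castSucc_lt_last i).ne
        simpa [this] using (horth i).2.2.1
      · simpa using h.ef i j
    · intro i
      refine Fin.lastCases ?_ (fun i => ?_) i
      · simpa using hPuv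
      · simpa using hP i

/-- The projection of a vector to the symplectic complement of a symplectic family. -/
theorem IsSymplecticFamily.exists_projection {B : V →ₗ[ℝ] V →ₗ[ℝ] ℝ} (hB : B.IsAlt) {k : ℕ}
    {e f : Fin k → V} (h : IsSymplecticFamily B e f) (v : V) :
    ∃ v', (∀ i, B (e i) v' = 0 ∧ B (f i) v' = 0) ∧
      ∀ u, (∀ i, B (e i) u = 0 ∧ B (f i) u = 0) → B u v' = B u v := by
  have hfe : ∀ i j, B (f i) (e j) = if i = j then -2 else 0 := fun i j => by
    rw [← hB.neg, h.ef]
    split_ifs <;> simp_all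
  -- The factor 1/2 compensates the normalization B(eᵢ, fᵢ) = 2.
  refine ⟨v - ∑ i, ((B (e i) v / 2) • f i - (B (f i) v / 2) • e i), fun i => ⟨?_, ?_⟩,
    fun u hu => ?_⟩
  · simp [h.ee, h.ef, mul_ite]
  · simp [hfe, h.ff, mul_ite]
  · have : ∀ i, B u (e i) = 0 ∧ B u (f i) = 0 := fun i => by
      rw [← hB.neg (e i), ← hB.neg (f i), (hu i).1, (hu i).2]
      simp
    simp [this]

/-- The complement is the common kernel of 2k linear functionals. -/
theorem exists_ne_zero_in_complement [FiniteDimensional ℝ V] (B : V →ₗ[ℝ] V →ₗ[ℝ] ℝ) {k : ℕ}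
    (e f : Fin k → V) (hk : 2 * k < Module.finrank ℝ V) :
    ∃ u, u ≠ 0 ∧ ∀ i, B (e i) u = 0 ∧ B (f i) u = 0 := by
  let T : V →ₗ[ℝ] (Fin k → ℝ) × (Fin k → ℝ) :=
    (LinearMap.pi fun i => B (e i)).prod (LinearMap.pi fun i => B (f i))
  have : T.ker ≠ ⊥ := LinearMap.ker_ne_bot_of_finrank_lt (by simp; omega)
  obtain ⟨u, hu, hu0⟩ := (Submodule.ne_bot_iff _).1 this
  rw [LinearMap.mem_ker, Prod.ext_iff] at hu
  exact ⟨u, hu0, fun i => ⟨congrFun hu.1 i, congrFun hu.2 i⟩⟩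

/-- The linear coordinates defined by a symplectic family of maximal size. -/
theorem IsSymplecticFamily.exists_coordinates [FiniteDimensional ℝ V] {B : V →ₗ[ℝ] V →ₗ[ℝ] ℝ}
    (hB : B.IsAlt) {n : ℕ} {e f : Fin n → V} (h : IsSymplecticFamily B e f)
    (hn : Module.finrank ℝ V = 2 * n) :
    ∃ L : V ≃ₗ[ℝ] (Fin n → ℝ) × (Fin n → ℝ),
      (∀ v, v = ∑ i, ((L v).1 i • e i + (L v).2 i • f i)) ∧
      (∀ i, L (e i) = (Pi.single i 1, 0)) ∧ (∀ i, L (f i) = (0, Pi.single i 1)) ∧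
      ∀ u v, B u v = 2 * ∑ i, ((L u).1 i * (L v).2 i - (L v).1 i * (L u).2 i) := by
  have hfe : ∀ i j, B (f i) (e j) = if i = j then -2 else 0 := fun i j => by
    rw [← hB.neg, h.ef]
    split_ifs <;> simp_all
  let S : (Fin n → ℝ) × (Fin n → ℝ) →ₗ[ℝ] V :=
    (Fintype.linearCombination ℝ e).coprod (Fintype.linearCombination ℝ f)
  have hS : ∀ a, S a = ∑ i, (a.1 i • e i + a.2 i • f i) := fun a => by
    simp [S, Fintype.linearCombination_apply, Finset.sum_add_distrib]
  have he : ∀ a i, B (e i) (S a) = 2 * a.2 i := fun a i => by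
    rw [hS]; simp [h.ee, h.ef, mul_comm]
  have hf : ∀ a i, B (f i) (S a) = -2 * a.1 i := fun a i => by
    rw [hS]; simp [h.ff, hfe, mul_comm]
  have hinj : Function.Injective S := by
    refine (injective_iff_map_eq_zero S).2 fun a ha => ?_
    ext i
    · have := hf a i
      rw [ha] at this
      simpa using this
    · have := he a i
      rw [ha] at this
      simpa using this
  let L := (LinearEquiv.ofInjectiveOfFinrankEq S hinj (by simp; omega)).symm
  have hSL : ∀ v, S (L v) = v := fun v =>
    (LinearEquiv.ofInjectiveOfFinrankEq S hinj (by simp; omega)).apply_symm_apply v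
  have hLS : ∀ a, L (S a) = a := fun a => hinj (hSL _)
  refine ⟨L, fun v => by rw [← hS, hSL], fun i => ?_, fun i => ?_, fun u v => ?_⟩
  · rw [← hLS (Pi.single i 1, 0), hS]
    simp [Pi.single_apply, ite_smul]
  · rw [← hLS (0, Pi.single i 1), hS]
    simp [Pi.single_apply, ite_smul]
  · conv_lhs => rw [← hSL u, hS, ← hSL v]
    simp only [map_sum, map_add, map_smul, LinearMap.sum_apply, LinearMap.add_apply,
      LinearMap.smul_apply, he, hf, smul_eq_mul, Finset.mul_sum]
    exact Finset.sum_congr rfl fun i _ => by ring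

/-- Linear Darboux theorem. -/
theorem exists_symplectic_coordinates [FiniteDimensional ℝ V] {B : V →ₗ[ℝ] V →ₗ[ℝ] ℝ}
    (hB : B.IsAlt) (hnd : ∀ v, (∀ w, B v w = 0) → v = 0) {n : ℕ}
    (hn : Module.finrank ℝ V = 2 * n) :
    ∃ L : V ≃ₗ[ℝ] (Fin n → ℝ) × (Fin n → ℝ),
      ∀ u v, B u v = 2 * ∑ i, ((L u).1 i * (L v).2 i - (L v).1 i * (L u).2 i) := by
  obtain ⟨e, f, h, -⟩ := exists_isSymplecticFamily hB (n := n) (fun _ _ => True) (by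
    intro k hk e f h _
    obtain ⟨u, hu0, hu⟩ := exists_ne_zero_in_complement B e f (by omega)
    obtain ⟨w, hw⟩ : ∃ w, B u w ≠ 0 := by
      by_contra! hcon
      exact hu0 (hnd u hcon)
    obtain ⟨v, hv, hvw⟩ := h.exists_projection hB w
    rw [← hvw u hu] at hw
    refine ⟨u, (2 / B u v) • v, by simp [hw], trivial, fun i => ?_⟩
    simp [hu i, hv i])
  obtain ⟨L, -, -, -, hL⟩ := h.exists_coordinates hB hn
  exact ⟨L, hL⟩

/-- Symplectic linear coordinates adapted to a (pseudo-)Hermitian complex structure: the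
complexifications of both halves of the coordinates are injective. -/
theorem exists_hermitian_coordinates [FiniteDimensional ℝ V] {B : V →ₗ[ℝ] V →ₗ[ℝ] ℝ}
    (hB : B.IsAlt) (hnd : ∀ v, (∀ w, B v w = 0) → v = 0) {n : ℕ}
    (hn : Module.finrank ℝ V = 2 * n) (K : V →ₗ[ℝ] V) (hK : ∀ v, K (K v) = -v)
    (hBK : ∀ u v, B (K u) (K v) = B u v) :
    ∃ L : V ≃ₗ[ℝ] (Fin n → ℝ) × (Fin n → ℝ),
      (∀ u v, B u v = 2 * ∑ i, ((L u).1 i * (L v).2 i - (L v).1 i * (L u).2 i)) ∧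
      (∀ v, (L v).1 = 0 → (L (K v)).1 = 0 → v = 0) ∧
      ∀ v, (L v).2 = 0 → (L (K v)).2 = 0 → v = 0 := by
  have hK' : ∀ u v, B (K u) v = -B u (K v) := fun u v => by
    rw [← hBK u, hK]; simp
  obtain ⟨e, f, h, hP⟩ := exists_isSymplecticFamily hB (n := n)
    (fun u v => ∃ ε : ℝ, ε ≠ 0 ∧ v = ε • K u) (by
    intro k hk e f h hP
    obtain ⟨u, hu0, hu⟩ := exists_ne_zero_in_complement B e f (by omega)
    -- K exchanges the lines of eᵢ and fᵢ, so the symplectic complement is K-invariant.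
    have hcK : ∀ v, (∀ i, B (e i) v = 0 ∧ B (f i) v = 0) →
        ∀ i, B (e i) (K v) = 0 ∧ B (f i) (K v) = 0 := by
      intro v hv i
      obtain ⟨ε, hε, hi⟩ := hP i
      have h1 := hv i
      rw [hi] at h1 ⊢
      simp only [map_smul, LinearMap.smul_apply, hK', hK, map_neg, neg_neg, smul_eq_mul] at h1 ⊢
      refine ⟨?_, by simp [h1.1]⟩
      simpa [hε] using h1.2
    -- The form B(·, K·) is symmetric. If its quadratic form vanished on the complement,
    -- polarization would make it zero there; testing u against the projection of -Kw then gives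
    -- B(u, w) = 0 for all w, which contradicts nondegeneracy.
    obtain ⟨w, hw, hw0⟩ : ∃ w, (∀ i, B (e i) w = 0 ∧ B (f i) w = 0) ∧ B w (K w) ≠ 0 := by
      by_contra! hcon
      refine hu0 (hnd u fun w => ?_)
      obtain ⟨v, hv, hvw⟩ := h.exists_projection hB (-(K w))
      have h1 := hcon u hu
      have h2 := hcon v hv
      have h3 := hcon (u + v) fun i => by simp [hu i, hv i]
      have h4 : B v (K u) = B u (K v) := by rw [← hB.neg, hK', neg_neg]
      have h5 : B u (K v) = 0 := by
        simp only [map_add, LinearMap.add_apply] at h3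
        linarith
      have h6 := hvw (K u) (hcK u hu)
      rw [hK', h5, map_neg, hBK] at h6
      linarith
    -- The coefficient may be negative, since the associated Hermitian form need not be definite.
    refine ⟨w, (2 / B w (K w)) • K w, by simp [hw0], ⟨_, by positivity, rfl⟩, fun i => ?_⟩
    simp [hw i, hcK w hw i])
  obtain ⟨L, hsum, hLe, hLf, hL⟩ := h.exists_coordinates hB hn
  choose ε hε hfe using hP
  refine ⟨L, hL, fun v h1 h2 => ?_, fun v h1 h2 => ?_⟩
  · have hv := hsum v
    simp only [h1, Pi.zero_apply, zero_smul, zero_add] at hv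
    -- Here v lies in the span of the fᵢ, and K maps this span injectively into that of the eᵢ,
    -- where only the first coordinates are nonzero.
    have hKv : K v = -∑ i, ((L v).2 i * ε i) • e i := by
      conv_lhs => rw [hv]
      simp [hfe, hK, mul_smul]
    rw [hKv] at h2
    refine L.map_eq_zero_iff.1 (Prod.ext h1 (funext fun i => ?_))
    have h3 := congrFun h2 i
    simp only [map_neg, map_sum, map_smul, hLe, Prod.fst_neg, Prod.fst_sum, Prod.smul_fst,
      Pi.neg_apply, Finset.sum_apply, Pi.smul_apply, Pi.single_apply, smul_eq_mul, mul_ite, mul_one,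
      mul_zero, Finset.sum_ite_eq, Finset.mem_univ, if_true, Pi.zero_apply] at h3
    simpa [hε i] using h3
  · have hv := hsum v
    simp only [h1, Pi.zero_apply, zero_smul, add_zero] at hv
    have hKe : ∀ i, K (e i) = (ε i)⁻¹ • f i := fun i => by
      rw [hfe, smul_smul, inv_mul_cancel₀ (hε i), one_smul]
    have hKv : K v = ∑ i, ((L v).1 i * (ε i)⁻¹) • f i := by
      conv_lhs => rw [hv]
      simp [hKe, mul_smul]
    rw [hKv] at h2
    refine L.map_eq_zero_iff.1 (Prod.ext (funext fun i => ?_) h1)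
    have h3 := congrFun h2 i
    simp only [map_sum, map_smul, hLf, Prod.snd_sum, Prod.smul_snd,
      Finset.sum_apply, Pi.smul_apply, Pi.single_apply, smul_eq_mul, mul_ite, mul_one,
      mul_zero, Finset.sum_ite_eq, Finset.mem_univ, if_true, Pi.zero_apply] at h3
    simpa [hε i] using h3

end LinearAlgebra

/-! ### Homogeneous holomorphic potentials in a chart -/

section Potential

variable {E : Type*} [NormedAddCommGroup E] [NormedSpace ℂ E]

/-- The complex linear functional `v ↦ T v - i T (i v)` with real part `T`. -/
noncomputable def complexifyFunctional (T : E →L[ℝ] ℝ) : E →L[ℂ] ℂ :=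
  StrongDual.extendRCLike (𝕜 := ℂ) T

theorem complexifyFunctional_apply (T : E →L[ℝ] ℝ) (v : E) :
    complexifyFunctional T v = (T v : ℂ) - Complex.I * (T (Complex.I • v) : ℂ) := by
  simp [complexifyFunctional, StrongDual.extendRCLike_apply]

theorem complexifyFunctional_re (T : E →L[ℝ] ℝ) (v : E) : (complexifyFunctional T v).re = T v := by
  simp [complexifyFunctional_apply]

/-- Local data of a conic action in a chart centred at `x₀`: a parallel frame `g` with inverse `h`
and connection form `Γ`, and the holomorphic action `Φ`. -/
structure IsConicModel (Γ : E → E →L[ℝ] E →L[ℝ] E) (g h : E → E →L[ℝ] E) (Φ : ℂ × E → E)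
    (x₀ : E) : Prop where
  hasFDerivAt_g : ∀ᶠ x in 𝓝 x₀,
    HasFDerivAt g (-((ContinuousLinearMap.mul ℝ (E →L[ℝ] E)).flip (g x) ∘L Γ x)) x
  hasFDerivAt_h : ∀ᶠ x in 𝓝 x₀,
    HasFDerivAt h (ContinuousLinearMap.mul ℝ (E →L[ℝ] E) (h x) ∘L Γ x) x
  g_mul_h : ∀ᶠ x in 𝓝 x₀, g x * h x = 1
  symm : ∀ᶠ x in 𝓝 x₀, ∀ u v, Γ x u v = Γ x v u
  contDiffAt : ContDiffAt ℂ 2 Φ (1, x₀)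
  one_act : ∀ᶠ x in 𝓝 x₀, Φ (1, x) = x
  mul_act : ∀ᶠ z : ℂ × ℂ × E in 𝓝 (1, 1, x₀), Φ (z.1, Φ (z.2.1, z.2.2)) = Φ (z.1 * z.2.1, z.2.2)
  conic : ∀ᶠ z : ℂ × E in 𝓝 (1, x₀), ∀ v,
    fderiv ℝ (fun y => Φ (z.1, y)) z.2 (g z.2 v) = z.1 • g (Φ z) v

/-- The generating vector field of the action `Φ`. -/
noncomputable def generator (Φ : ℂ × E → E) (x : E) : E := fderiv ℂ Φ (1, x) (1, 0)

/-- The homogeneous holomorphic function with real part `T (h ξ)`. -/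
noncomputable def potential (h : E → E →L[ℝ] E) (Φ : ℂ × E → E) (T : E →L[ℝ] ℝ) (x : E) : ℂ :=
  complexifyFunctional (T ∘L h x) (generator Φ x)

variable {Γ : E → E →L[ℝ] E →L[ℝ] E} {g h : E → E →L[ℝ] E} {Φ : ℂ × E → E} {x₀ : E}

/-- This is ∇(ηξ) = η·id for the generator ξ, with η = 1 and η = i as the essential cases. Applying
the parallel coframe h turns covariant derivatives into ordinary ones. -/
theorem IsConicModel.hasFDerivAt_coframe_generator (H : IsConicModel Γ g h Φ x₀) :
    ∀ᶠ x in 𝓝 x₀, ∀ η : ℂ, HasFDerivAt (fun y => h y (η • generator Φ y))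
      (h x ∘L (η • ContinuousLinearMap.id ℂ E).restrictScalars ℝ) x := by
  have htend : Filter.Tendsto (fun x : E => ((1 : ℂ), x)) (𝓝 x₀) (𝓝 (1, x₀)) :=
    (Continuous.prodMk_right (1 : ℂ)).tendsto x₀
  filter_upwards [H.hasFDerivAt_g, H.hasFDerivAt_h, H.g_mul_h, H.symm, H.one_act,
    htend.eventually (H.contDiffAt.eventually (by simp)),
    htend.eventually (eventually_eventually_nhds.2 (H.contDiffAt.eventually (by simp))),
    htend.eventually (eventually_eventually_nhds.2 H.conic)]
    with x hg hh hgh hsymm h1 hC hC' hconic η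
  have hCR : ContDiffAt ℝ 2 Φ (1, x) := hC.restrict_scalars ℝ
  have hsec : IsSymmSndFDerivAt ℝ Φ (1, x) := hCR.isSymmSndFDerivAt (by simp)
  set D₂ := fderiv ℝ (fderiv ℝ Φ) (1, x) with hD₂
  have hF : HasFDerivAt (fderiv ℝ Φ) D₂ (1, x) :=
    ((hCR.fderiv_right (m := 1) (by norm_num)).differentiableAt one_ne_zero).hasFDerivAt
  have hFC : ∀ᶠ z in 𝓝 ((1 : ℂ), x), HasFDerivAt Φ (fderiv ℝ Φ z) z ∧
      fderiv ℝ Φ z = (fderiv ℂ Φ z).restrictScalars ℝ := by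
    filter_upwards [hC'] with z hz
    have hd := hz.differentiableAt (by norm_num)
    exact ⟨(hd.restrictScalars ℝ).hasFDerivAt, hd.fderiv_restrictScalars ℝ⟩
  have hgen : ∀ᶠ y in 𝓝 x, fderiv ℝ Φ (1, y) (η, 0) = η • generator Φ y := by
    have ht : Filter.Tendsto (fun y : E => ((1 : ℂ), y)) (𝓝 x) (𝓝 (1, x)) :=
      (Continuous.prodMk_right (1 : ℂ)).tendsto x
    filter_upwards [ht.eventually hFC] with y hy
    rw [hy.2, generator, ContinuousLinearMap.coe_restrictScalars', ← map_smul]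
    simp
  -- the derivative of the generator in direction `w`
  have hmixed : ∀ w, D₂ (0, w) (η, 0) = η • w - Γ x (η • generator Φ x) w := by
    intro w
    set v := h x w with hv
    have hgv : g x v = w := by
      have := congrArg (fun T : E →L[ℝ] E => T w) hgh
      simpa [hv] using this
    -- The conic equation determines the derivative in x for each c. Symmetry of the second
    -- derivative therefore lets it be differentiated in c to find the x-derivative of the
    -- generator.
    rw [hsec (0, w) (η, 0)]
    have hι : HasFDerivAt (fun c : ℂ => (c, x)) (ContinuousLinearMap.inl ℝ ℂ E) 1 :=
      hasFDerivAt_prodMk_left 1 x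
    have hl : HasFDerivAt (fun c : ℂ => fderiv ℝ Φ (c, x) (0, w))
        ((D₂ ∘L ContinuousLinearMap.inl ℝ ℂ E).flip (0, w)) 1 := by
      have := (hF.comp (1 : ℂ) hι).clm_apply (hasFDerivAt_const ((0 : ℂ), w) (1 : ℂ))
      simpa using this
    have hgΦ : HasFDerivAt (fun c : ℂ => g (Φ (c, x)))
        ((-((ContinuousLinearMap.mul ℝ (E →L[ℝ] E)).flip (g x) ∘L Γ x)) ∘L
          (fderiv ℝ Φ (1, x) ∘L ContinuousLinearMap.inl ℝ ℂ E)) 1 := by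
      have h2 : HasFDerivAt (fun c : ℂ => Φ (c, x))
          (fderiv ℝ Φ (1, x) ∘L ContinuousLinearMap.inl ℝ ℂ E) 1 :=
        (hFC.self_of_nhds.1).comp (1 : ℂ) hι
      have h3 : HasFDerivAt g (-((ContinuousLinearMap.mul ℝ (E →L[ℝ] E)).flip (g x) ∘L Γ x))
          (Φ (1, x)) := by rw [h1]; exact hg
      exact h3.comp (1 : ℂ) h2
    have hr := (hasFDerivAt_id (𝕜 := ℝ) (1 : ℂ)).smul
      (hgΦ.clm_apply (hasFDerivAt_const v (1 : ℂ)))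
    have heq : (fun c : ℂ => fderiv ℝ Φ (c, x) (0, w)) =ᶠ[𝓝 1]
        fun c => id c • g (Φ (c, x)) v := by
      have ht : Filter.Tendsto (fun c : ℂ => (c, x)) (𝓝 1) (𝓝 (1, x)) :=
        (Continuous.prodMk_left x).tendsto 1
      filter_upwards [ht.eventually hFC, ht.eventually hconic] with c hc hc'
      have h2 : HasFDerivAt (fun y => Φ (c, y))
          (fderiv ℝ Φ (c, x) ∘L ContinuousLinearMap.inr ℝ ℂ E) x :=
        hc.1.comp x (hasFDerivAt_prodMk_right c x)
      have h3 := hc' v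
      simp only [h2.fderiv, hgv] at h3
      simpa using h3
    have huniq := (hl.congr_of_eventuallyEq heq.symm).unique hr
    have h4 := congrArg (fun T : ℂ →L[ℝ] E => T η) huniq
    simp only [ContinuousLinearMap.flip_apply, ContinuousLinearMap.comp_apply,
      ContinuousLinearMap.inl_apply] at h4
    rw [h4]
    simp [h1, hgv, hgen.self_of_nhds]
    abel
  have hξ : HasFDerivAt (fun y => η • generator Φ y)
      ((D₂ ∘L ContinuousLinearMap.inr ℝ ℂ E).flip (η, 0)) x := by
    have := (hF.comp x (hasFDerivAt_prodMk_right (1 : ℂ) x)).clm_apply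
      (hasFDerivAt_const (η, (0 : E)) x)
    refine HasFDerivAt.congr_of_eventuallyEq ?_ (hgen.mono fun y hy => hy.symm)
    simpa using this
  -- The derivative hΓ of h contributes hΓ(w)(ηξ), which cancels -hΓ(ηξ)(w) because Γ is symmetric.
  refine (hh.clm_apply hξ).congr_fderiv ?_
  ext w
  have := hmixed w
  simp [this, hsymm (η • generator Φ x) w]

theorem potential_eq (T : E →L[ℝ] ℝ) (x : E) : potential h Φ T x
    = (T (h x (generator Φ x)) : ℂ) - Complex.I * (T (h x (Complex.I • generator Φ x)) : ℂ) := by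
  simp [potential, complexifyFunctional_apply]

/-- The cases η = 1 and η = i of the preceding lemma give the real and imaginary parts of the
derivative. The resulting real derivative T∘h - iT∘h∘i is complex linear, hence a complex
derivative. -/
theorem IsConicModel.hasFDerivAt_potential (H : IsConicModel Γ g h Φ x₀) :
    ∀ᶠ x in 𝓝 x₀, ∀ T : E →L[ℝ] ℝ,
      HasFDerivAt (potential h Φ T) (complexifyFunctional (T ∘L h x)) x := by
  filter_upwards [H.hasFDerivAt_coframe_generator] with x hx T
  have h1 := Complex.ofRealCLM.hasFDerivAt.comp x (T.hasFDerivAt.comp x (hx 1))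
  have h2 := Complex.ofRealCLM.hasFDerivAt.comp x (T.hasFDerivAt.comp x (hx Complex.I))
  have h3 := h1.sub (h2.const_mul Complex.I)
  refine hasFDerivAt_of_restrictScalars ℝ (h3.congr_of_eventuallyEq
    (Filter.Eventually.of_forall fun y => ?_)) ?_
  · simp [potential_eq]
  · ext v
    simp [complexifyFunctional_apply]

/-- The potential F is, by its definition, its own derivative applied to the generator. Along an
orbit this reads dF/dc = F/c, so F(Φ(c, x))/c is constant on a disc around c = 1. -/
theorem IsConicModel.potential_act (H : IsConicModel Γ g h Φ x₀) :
    ∀ᶠ z : ℂ × E in 𝓝 (1, x₀), ∀ T : E →L[ℝ] ℝ,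
      potential h Φ T (Φ z) = z.1 * potential h Φ T z.2 := by
  have hΦ1 : Φ (1, x₀) = x₀ := H.one_act.self_of_nhds
  have hΦt : Filter.Tendsto Φ (𝓝 (1, x₀)) (𝓝 x₀) := by
    have := H.contDiffAt.continuousAt.tendsto
    rwa [hΦ1] at this
  have hmul : ∀ᶠ z : ℂ × E in 𝓝 (1, x₀), ∀ᶠ a in 𝓝 (1 : ℂ),
      Φ (a, Φ z) = Φ (a * z.1, z.2) := by
    have h1 := eventually_eventually_nhds.2 H.mul_act
    have ht : Filter.Tendsto (fun z : ℂ × E => ((1 : ℂ), z.1, z.2)) (𝓝 (1, x₀))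
        (𝓝 (1, 1, x₀)) := by
      apply Continuous.tendsto (f := fun z : ℂ × E => ((1 : ℂ), z.1, z.2))
      fun_prop
    filter_upwards [ht.eventually h1] with z hz
    have ht' : Filter.Tendsto (fun a : ℂ => (a, z.1, z.2)) (𝓝 1) (𝓝 (1, z.1, z.2)) := by
      apply Continuous.tendsto (f := fun a : ℂ => (a, z.1, z.2))
      fun_prop
    exact ht'.eventually hz
  have hdiff : ∀ᶠ z : ℂ × E in 𝓝 (1, x₀), DifferentiableAt ℂ Φ z :=
    (H.contDiffAt.eventually (by simp)).mono fun z hz => hz.differentiableAt (by norm_num)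
  have htend : Filter.Tendsto (fun z : ℂ × E => ((1 : ℂ), Φ z)) (𝓝 (1, x₀)) (𝓝 (1, x₀)) :=
    tendsto_const_nhds.prodMk_nhds hΦt
  have hball : ∀ᶠ z : ℂ × E in 𝓝 (1, x₀), z.1 ≠ 0 ∧ ∀ T : E →L[ℝ] ℝ,
      HasDerivAt (fun c => potential h Φ T (Φ (c, z.2)))
        (z.1⁻¹ * potential h Φ T (Φ z)) z.1 := by
    have hne : ∀ᶠ z : ℂ × E in 𝓝 (1, x₀), z.1 ≠ 0 :=
      (continuous_fst.tendsto ((1 : ℂ), x₀)).eventually_ne one_ne_zero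
    filter_upwards [hne, hmul, hdiff, htend.eventually hdiff,
      hΦt.eventually H.hasFDerivAt_potential] with z hz0 hz hd hd' hpot
    refine ⟨hz0, fun T => ?_⟩
    have e1 : HasDerivAt (fun a => Φ (a, Φ z)) (generator Φ (Φ z)) 1 :=
      hd'.hasFDerivAt.comp_hasDerivAt_of_eq (1 : ℂ)
        ((hasDerivAt_id (1 : ℂ)).prodMk (hasDerivAt_const _ (Φ z))) rfl
    have e2 : HasDerivAt (fun c => Φ (c, z.2)) (fderiv ℂ Φ z (1, 0)) z.1 :=
      hd.hasFDerivAt.comp_hasDerivAt_of_eq z.1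
        ((hasDerivAt_id z.1).prodMk (hasDerivAt_const _ z.2)) rfl
    have e3 : HasDerivAt (fun a => Φ (a * z.1, z.2)) (z.1 • fderiv ℂ Φ z (1, 0)) 1 := by
      have e4 : HasDerivAt (fun a : ℂ => a * z.1) z.1 1 := by
        simpa using (hasDerivAt_id (1 : ℂ)).mul_const z.1
      exact HasDerivAt.scomp_of_eq (1 : ℂ) e2 e4 (by simp)
    -- The group law differentiated at a = 1: the generator at Φ(c, x) is c ∂Φ/∂c.
    have e5 : generator Φ (Φ z) = z.1 • fderiv ℂ Φ z (1, 0) :=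
      e1.unique (e3.congr_of_eventuallyEq hz)
    have e6 := (hpot T).comp_hasDerivAt_of_eq z.1 e2 rfl
    convert! e6 using 1
    rw [potential, e5, map_smul, smul_eq_mul, inv_mul_cancel_left₀ hz0]
  -- A ball of the product metric is a product of balls, so the whole disc of parameters, with its
  -- centre 1, is available over each nearby point.
  obtain ⟨ε, hε, hb⟩ := Metric.eventually_nhds_iff_ball.1 (hball.and
    ((continuous_snd.tendsto ((1 : ℂ), x₀)).eventually H.one_act))
  filter_upwards [Metric.ball_mem_nhds _ hε] with z hz T
  have hmem : ∀ c ∈ Metric.ball (1 : ℂ) ε, (c, z.2) ∈ Metric.ball ((1 : ℂ), x₀) ε := by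
    intro c hc
    rw [← ball_prod_same] at hz ⊢
    exact ⟨hc, hz.2⟩
  have hder : ∀ c ∈ Metric.ball (1 : ℂ) ε,
      HasDerivAt (fun c => c⁻¹ * potential h Φ T (Φ (c, z.2))) 0 c := by
    intro c hc
    obtain ⟨⟨hc0, hc'⟩, -⟩ := hb _ (hmem c hc)
    convert! (hasDerivAt_inv hc0).mul (hc' T) using 1
    field_simp
    simp
  have hconst := Metric.isOpen_ball.is_const_of_deriv_eq_zero
    (convex_ball (1 : ℂ) ε).isPreconnected
    (fun c hc => (hder c hc).differentiableAt.differentiableWithinAt)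
    (fun c hc => (hder c hc).deriv) (x := z.1) (y := 1)
    (by rw [← ball_prod_same] at hz; exact hz.1) (Metric.mem_ball_self hε)
  obtain ⟨⟨hc0, -⟩, hone⟩ := hb z hz
  simp only [Prod.mk.eta, hone, inv_one, one_mul] at hconst
  rw [← hconst, mul_inv_cancel_left₀ hc0]

end Potential

/-! ### Holomorphic maps as real differentiable maps -/

section RestrictScalars

variable {E : Type*} [NormedAddCommGroup E] [NormedSpace ℂ E]
  {M : Type*} [TopologicalSpace M] [ChartedSpace E M]
  {F : Type*} [NormedAddCommGroup F] [NormedSpace ℂ F]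
  {N : Type*} [TopologicalSpace N] [ChartedSpace F N]

/-- A complex derivative between complex manifolds is also a real derivative. -/
theorem hasMFDerivAt_restrictScalars {f : M → N} {q : M}
    (hf : MDifferentiableAt 𝓘(ℂ, E) 𝓘(ℂ, F) f q) :
    HasMFDerivAt 𝓘(ℝ, E) 𝓘(ℝ, F) f q
      ((mfderiv 𝓘(ℂ, E) 𝓘(ℂ, F) f q : E →L[ℂ] F).restrictScalars ℝ : E →L[ℝ] F) := by
  have h := hf.hasMFDerivAt
  exact ⟨h.1, HasFDerivWithinAt.restrictScalars ℝ h.2⟩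

/-- The real derivative of a holomorphic map commutes with the complex structures. -/
theorem mfderiv_J {f : M → N} {q : M} (hf : MDifferentiableAt 𝓘(ℂ, E) 𝓘(ℂ, F) f q)
    (v : TangentSpace 𝓘(ℝ, E) q) :
    mfderiv 𝓘(ℝ, E) 𝓘(ℝ, F) f q (J q v) = J (f q) (mfderiv 𝓘(ℝ, E) 𝓘(ℝ, F) f q v) := by
  rw [(hasMFDerivAt_restrictScalars hf).mfderiv]
  exact (mfderiv 𝓘(ℂ, E) 𝓘(ℂ, F) f q : E →L[ℂ] F).map_smul Complex.I (v : E)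

end RestrictScalars

/-! ### Tangent vectors and vector fields in a chart -/

section Chart

variable {E : Type*} [NormedAddCommGroup E] [NormedSpace ℂ E] [FiniteDimensional ℂ E]
  {M : Type*} [TopologicalSpace M] [ChartedSpace E M] [IsManifold 𝓘(ℂ, E) ω M]

/-- The tangent space at `q` in the chart at `p`. -/
noncomputable def toModel (p q : M) : TangentSpace 𝓘(ℝ, E) q →L[ℝ] E :=
  (trivializationAt E (TangentSpace 𝓘(ℝ, E)) p).continuousLinearMapAt ℝ q

/-- The inverse of `toModel`. -/
noncomputable def ofModel (p q : M) : E →L[ℝ] TangentSpace 𝓘(ℝ, E) q :=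
  (trivializationAt E (TangentSpace 𝓘(ℝ, E)) p).symmL ℝ q

variable {p q : M}

omit [FiniteDimensional ℂ E] in
theorem ofModel_toModel (hq : q ∈ (chartAt E p).source) (v : TangentSpace 𝓘(ℝ, E) q) :
    ofModel p q (toModel p q v) = v :=
  (trivializationAt E (TangentSpace 𝓘(ℝ, E)) p).symmL_continuousLinearMapAt
    (by simpa using hq) v

omit [FiniteDimensional ℂ E] in
theorem toModel_ofModel (hq : q ∈ (chartAt E p).source) (v : E) :
    toModel p q (ofModel p q v) = v :=
  (trivializationAt E (TangentSpace 𝓘(ℝ, E)) p).continuousLinearMapAt_symmL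
    (by simpa using hq) v

omit [FiniteDimensional ℂ E] in
theorem toModel_eq_dR (hq : q ∈ (chartAt E p).source) :
    toModel p q = dR (chartAt E p) q :=
  TangentBundle.continuousLinearMapAt_trivializationAt hq

omit [FiniteDimensional ℂ E] [IsManifold 𝓘(ℂ, E) ω M] in
/-- The real differential of a holomorphic function is complex linear. -/
theorem dR_J {F : Type*} [NormedAddCommGroup F] [NormedSpace ℂ F] {f : M → F}
    (hf : MDifferentiableAt 𝓘(ℂ, E) 𝓘(ℂ, F) f q) (v : TangentSpace 𝓘(ℝ, E) q) :
    dR f q (J q v) = Complex.I • dR f q v :=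
  mfderiv_J hf v

omit [FiniteDimensional ℂ E] in
theorem toModel_J (hq : q ∈ (chartAt E p).source) (v : TangentSpace 𝓘(ℝ, E) q) :
    toModel p q (J q v) = Complex.I • toModel p q v := by
  rw [toModel_eq_dR hq]
  exact dR_J ((mdifferentiable_chart p).mdifferentiableAt hq) v

omit [FiniteDimensional ℂ E] in
theorem hasMFDerivAt_chart (hq : q ∈ (chartAt E p).source) :
    HasMFDerivAt 𝓘(ℝ, E) 𝓘(ℝ, E) (chartAt E p) q (toModel p q) := by
  rw [toModel_eq_dR hq]
  exact ((mdifferentiable_chart (I := 𝓘(ℝ, E)) p).mdifferentiableAt hq).hasMFDerivAt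

omit [FiniteDimensional ℂ E] in
/-- The derivative of a function given in the chart at `p`. -/
theorem hasMFDerivAt_comp_chart {F : Type*} [NormedAddCommGroup F] [NormedSpace ℝ F] {k : E → F}
    {k' : E →L[ℝ] F} (hq : q ∈ (chartAt E p).source) (hk : HasFDerivAt k k' (chartAt E p q)) :
    HasMFDerivAt 𝓘(ℝ, E) 𝓘(ℝ, F) (fun x : M => k (chartAt E p x)) q (k' ∘L toModel p q) :=
  HasMFDerivAt.comp q hk.hasMFDerivAt (hasMFDerivAt_chart hq)

omit [FiniteDimensional ℂ E] in
theorem dR_of_eventuallyEq_comp_chart {F : Type*} [NormedAddCommGroup F] [NormedSpace ℝ F]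
    {f : M → F} {k : E → F} {k' : E →L[ℝ] F} (hq : q ∈ (chartAt E p).source)
    (hk : HasFDerivAt k k' (chartAt E p q)) (hf : ∀ᶠ x in 𝓝 q, f x = k (chartAt E p x)) :
    dR f q = k' ∘L toModel p q :=
  ((hasMFDerivAt_comp_chart hq hk).congr_of_eventuallyEq hf).mfderiv

/-- The expression of a vector field in the chart at `p`. -/
noncomputable def modelField (p : M) (X : Π x : M, TangentSpace 𝓘(ℝ, E) x) (x : E) : E :=
  toModel p ((chartAt E p).symm x) (X ((chartAt E p).symm x))

omit [FiniteDimensional ℂ E] in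
theorem modelField_chart (X : Π x : M, TangentSpace 𝓘(ℝ, E) x) (hq : q ∈ (chartAt E p).source) :
    modelField p X (chartAt E p q) = toModel p q (X q) := by
  rw [modelField, (chartAt E p).left_inv hq]

/-- The vector field with the expression `Y` in the chart at `p`. -/
noncomputable def fieldOfModel (p : M) (Y : E → E) (q : M) : TangentSpace 𝓘(ℝ, E) q :=
  ofModel p q (Y (chartAt E p q))

omit [FiniteDimensional ℂ E] in
theorem modelField_fieldOfModel (Y : E → E) {x : E} (hx : x ∈ (chartAt E p).target) :
    modelField p (fieldOfModel p Y) x = Y x := by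
  rw [modelField, fieldOfModel, toModel_ofModel ((chartAt E p).map_target hx),
    (chartAt E p).right_inv hx]

omit [FiniteDimensional ℂ E] in
theorem contMDiffAt_iff_model {F : Type*} [NormedAddCommGroup F] [NormedSpace ℝ F] {f : M → F}
    {n : WithTop ℕ∞} (hq : q ∈ (chartAt E p).source) :
    ContMDiffAt 𝓘(ℝ, E) 𝓘(ℝ, F) n f q ↔
      ContDiffAt ℝ n (f ∘ (chartAt E p).symm) (chartAt E p q) := by
  have : IsManifold 𝓘(ℝ, E) n M := IsManifold.of_le (n := ω) le_top
  rw [contMDiffAt_iff_source_of_mem_source hq]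
  simp [contMDiffWithinAt_iff_contDiffWithinAt, contDiffWithinAt_univ]

omit [FiniteDimensional ℂ E] in
theorem mdifferentiableAt_iff_model {F : Type*} [NormedAddCommGroup F] [NormedSpace ℝ F]
    {f : M → F} (hq : q ∈ (chartAt E p).source) :
    MDifferentiableAt 𝓘(ℝ, E) 𝓘(ℝ, F) f q ↔
      DifferentiableAt ℝ (f ∘ (chartAt E p).symm) (chartAt E p q) := by
  rw [mdifferentiableAt_iff_source_of_mem_source hq]
  simp [mdifferentiableWithinAt_iff_differentiableWithinAt, differentiableWithinAt_univ]

omit [FiniteDimensional ℂ E] in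
theorem trivialization_eventuallyEq_toModel (X : Π x : M, TangentSpace 𝓘(ℝ, E) x)
    (hq : q ∈ (chartAt E p).source) :
    (fun x => (trivializationAt E (TangentSpace 𝓘(ℝ, E)) p ⟨x, X x⟩).2) =ᶠ[𝓝 q]
      fun x => toModel p x (X x) := by
  filter_upwards [(chartAt E p).open_source.mem_nhds hq] with x hx
  have hx' : x ∈ (trivializationAt E (TangentSpace 𝓘(ℝ, E)) p).baseSet := by simpa using hx
  rw [toModel, Bundle.Trivialization.continuousLinearMapAt_apply,
    Bundle.Trivialization.coe_linearMapAt_of_mem _ hx']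

omit [FiniteDimensional ℂ E] in
theorem contMDiffAt_field_iff {n : WithTop ℕ∞} {X : Π x : M, TangentSpace 𝓘(ℝ, E) x}
    (hq : q ∈ (chartAt E p).source) :
    ContMDiffAt 𝓘(ℝ, E) 𝓘(ℝ, E).tangent n (fun x => (⟨x, X x⟩ : TangentBundle 𝓘(ℝ, E) M)) q ↔
      ContDiffAt ℝ n (modelField p X) (chartAt E p q) := by
  have : IsManifold 𝓘(ℝ, E) (n + 1) M := IsManifold.of_le (n := ω) le_top
  have : ContMDiffVectorBundle n E (TangentSpace 𝓘(ℝ, E) : M → Type _) 𝓘(ℝ, E) :=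
    TangentBundle.contMDiffVectorBundle
  have hq' : q ∈ (trivializationAt E (TangentSpace 𝓘(ℝ, E)) p).baseSet := by simpa using hq
  refine ((trivializationAt E (TangentSpace 𝓘(ℝ, E)) p).contMDiffAt_section_iff hq').trans ?_
  rw [(trivialization_eventuallyEq_toModel X hq).contMDiffAt_iff, contMDiffAt_iff_model hq]
  rfl

omit [FiniteDimensional ℂ E] in
theorem mdifferentiableAt_field_iff {X : Π x : M, TangentSpace 𝓘(ℝ, E) x}
    (hq : q ∈ (chartAt E p).source) :
    MDifferentiableAt 𝓘(ℝ, E) 𝓘(ℝ, E).tangent (fun x => (⟨x, X x⟩ : TangentBundle 𝓘(ℝ, E) M)) q ↔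
      DifferentiableAt ℝ (modelField p X) (chartAt E p q) := by
  have : ContMDiffVectorBundle 1 E (TangentSpace 𝓘(ℝ, E) : M → Type _) 𝓘(ℝ, E) :=
    TangentBundle.contMDiffVectorBundle
  have hq' : q ∈ (trivializationAt E (TangentSpace 𝓘(ℝ, E)) p).baseSet := by simpa using hq
  refine ((trivializationAt E (TangentSpace 𝓘(ℝ, E)) p).mdifferentiableAt_section_iff
    𝓘(ℝ, E) X hq').trans ?_
  rw [(trivialization_eventuallyEq_toModel X hq).mdifferentiableAt_iff,
    mdifferentiableAt_iff_model hq]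
  rfl

omit [FiniteDimensional ℂ E] in
theorem SmoothFieldOn.contMDiffAt {X : Π x : M, TangentSpace 𝓘(ℝ, E) x} {U : Set M}
    (hX : SmoothFieldOn X U) (hU : IsOpen U) (hq : q ∈ U) :
    ContMDiffAt 𝓘(ℝ, E) 𝓘(ℝ, E).tangent ∞ (fun x => (⟨x, X x⟩ : TangentBundle 𝓘(ℝ, E) M)) q :=
  (hX q hq).contMDiffAt (hU.mem_nhds hq)

omit [FiniteDimensional ℂ E] in
theorem SmoothFieldOn.mdifferentiableAt {X : Π x : M, TangentSpace 𝓘(ℝ, E) x} {U : Set M}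
    (hX : SmoothFieldOn X U) (hU : IsOpen U) (hq : q ∈ U) :
    MDifferentiableAt 𝓘(ℝ, E) 𝓘(ℝ, E).tangent
      (fun x => (⟨x, X x⟩ : TangentBundle 𝓘(ℝ, E) M)) q :=
  (hX.contMDiffAt hU hq).mdifferentiableAt (by simp)

omit [FiniteDimensional ℂ E] in
theorem eventually_modelField_fieldOfModel (Y : E → E) (hq : q ∈ (chartAt E p).source) :
    modelField p (fieldOfModel p Y) =ᶠ[𝓝 (chartAt E p q)] Y := by
  filter_upwards [(chartAt E p).open_target.mem_nhds ((chartAt E p).map_source hq)] with x hx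
  exact modelField_fieldOfModel Y hx

omit [FiniteDimensional ℂ E] in
theorem contMDiffAt_fieldOfModel {n : WithTop ℕ∞} {Y : E → E}
    (hq : q ∈ (chartAt E p).source) (hY : ContDiffAt ℝ n Y (chartAt E p q)) :
    ContMDiffAt 𝓘(ℝ, E) 𝓘(ℝ, E).tangent n
      (fun x => (⟨x, fieldOfModel p Y x⟩ : TangentBundle 𝓘(ℝ, E) M)) q :=
  (contMDiffAt_field_iff hq).2
    (hY.congr_of_eventuallyEq (eventually_modelField_fieldOfModel Y hq))

omit [FiniteDimensional ℂ E] in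
theorem smoothFieldOn_fieldOfModel {Y : E → E} {U : Set M} (hU : U ⊆ (chartAt E p).source)
    (hY : ∀ q ∈ U, ContDiffAt ℝ ∞ Y (chartAt E p q)) : SmoothFieldOn (fieldOfModel p Y) U :=
  fun q hq => (contMDiffAt_fieldOfModel (hU hq) (hY q hq)).contMDiffWithinAt

omit [FiniteDimensional ℂ E] in
theorem mdifferentiableAt_fieldOfModel {Y : E → E} (hq : q ∈ (chartAt E p).source)
    (hY : DifferentiableAt ℝ Y (chartAt E p q)) :
    MDifferentiableAt 𝓘(ℝ, E) 𝓘(ℝ, E).tangent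
      (fun x => (⟨x, fieldOfModel p Y x⟩ : TangentBundle 𝓘(ℝ, E) M)) q :=
  (mdifferentiableAt_field_iff hq).2
    (hY.congr_of_eventuallyEq (eventually_modelField_fieldOfModel Y hq))

/-- Coordinate vector fields commute. -/
theorem mlieBracket_fieldOfModel_const (u v : E) (hq : q ∈ (chartAt E p).source) :
    VectorField.mlieBracket 𝓘(ℝ, E) (fieldOfModel p fun _ => u) (fieldOfModel p fun _ => v) q
      = 0 := by
  let C : E → Π x : E, TangentSpace 𝓘(ℝ, E) x := fun w _ => w
  -- Coordinate fields are pullbacks of constant fields on E, whose bracket is zero, and the bracket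
  -- is natural under pullback.
  have hpull : ∀ w : E, (fieldOfModel p fun _ => w) =ᶠ[𝓝 q]
      VectorField.mpullback 𝓘(ℝ, E) 𝓘(ℝ, E) (chartAt E p) (C w) := by
    intro w
    filter_upwards [(chartAt E p).open_source.mem_nhds hq] with x hx
    have h1 : mfderiv 𝓘(ℝ, E) 𝓘(ℝ, E) (chartAt E p) x = toModel p x :=
      (hasMFDerivAt_chart hx).mfderiv
    have h2 : (toModel p x).inverse = ofModel (E := E) p x := by
      refine ContinuousLinearMap.inverse_eq ?_ ?_
      · exact ContinuousLinearMap.ext fun w => toModel_ofModel (E := E) hx w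
      · exact ContinuousLinearMap.ext fun w => ofModel_toModel (E := E) hx w
    have h3 := congrArg (fun T : TangentSpace 𝓘(ℝ, E) x →L[ℝ] E => T.inverse w) h1
    exact ((h3.trans (congrArg (fun T : E →L[ℝ] TangentSpace 𝓘(ℝ, E) x => T w) h2))).symm
  rw [(hpull u).mlieBracket_vectorField_eq (hpull v)]
  have hcm : ContMDiffAt 𝓘(ℝ, E) 𝓘(ℝ, E) 2 (chartAt E p) q :=
    (contMDiffAt_iff_model hq).2 (contDiffAt_id.congr_of_eventuallyEq (by
      filter_upwards [(chartAt E p).open_target.mem_nhds ((chartAt E p).map_source hq)] with x hx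
      exact (chartAt E p).right_inv hx))
  have hconst : ∀ (w : E), MDifferentiableAt 𝓘(ℝ, E) 𝓘(ℝ, E).tangent
      (fun x : E => (⟨x, C w x⟩ : TangentBundle 𝓘(ℝ, E) E)) (chartAt E p q) := by
    intro w
    have : ContMDiffAt 𝓘(ℝ, E) 𝓘(ℝ, E).tangent 1
      (fun x : E => (⟨x, C w x⟩ : TangentBundle 𝓘(ℝ, E) E)) (chartAt E p q) :=
      contMDiffAt_vectorSpace_iff_contDiffAt.2 contDiffAt_const
    exact this.mdifferentiableAt one_ne_zero
  have hzero : VectorField.mlieBracket 𝓘(ℝ, E) (C u) (C v) = 0 := by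
    rw [← VectorField.mlieBracketWithin_univ, VectorField.mlieBracketWithin_eq_lieBracketWithin]
    funext x
    simp [VectorField.lieBracketWithin, C]
    rfl
  rw [← VectorField.mpullback_mlieBracket (n := 2) (hconst u) (hconst v) hcm (by simp), hzero]
  exact map_zero _

end Chart

/-! ### Global extension of locally defined vector fields -/

section Extension

variable {E : Type*} [NormedAddCommGroup E] [NormedSpace ℂ E] [FiniteDimensional ℂ E]
  {M : Type*} [TopologicalSpace M] [T2Space M] [ChartedSpace E M] [IsManifold 𝓘(ℂ, E) ω M]

/-- A vector field that is smooth near `q` agrees near `q` with a globally smooth one. -/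
theorem exists_smooth_extension {X : Π x : M, TangentSpace 𝓘(ℝ, E) x} {U : Set M} {q : M}
    (hX : SmoothFieldOn X U) (hU : IsOpen U) (hq : q ∈ U) :
    ∃ X' : Π x : M, TangentSpace 𝓘(ℝ, E) x, SmoothFieldOn X' Set.univ ∧
      ∀ᶠ x in 𝓝 q, X' x = X x := by
  obtain ⟨f, -, hf⟩ := (SmoothBumpFunction.nhds_basis_tsupport (I := 𝓘(ℝ, E)) q).mem_iff.1
    (hU.mem_nhds hq)
  refine ⟨(f : M → ℝ) • X, ?_, ?_⟩
  · exact (ContMDiffOn.smul_section_of_tsupport f.contMDiff.contMDiffOn hU hf hX).contMDiffOn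
  · filter_upwards [f.eventuallyEq_one] with x hx
    simp [hx]

end Extension

/-! ### The connection form in a chart -/

section Christoffel

variable {E : Type*} [NormedAddCommGroup E] [NormedSpace ℂ E] [FiniteDimensional ℂ E]
  {M : Type*} [TopologicalSpace M] [ChartedSpace E M] [IsManifold 𝓘(ℂ, E) ω M]

variable {p q : M}

omit [FiniteDimensional ℂ E] in
theorem Connection.congr_of_eventuallyEq (D : Connection E M)
    {X Y : Π x : M, TangentSpace 𝓘(ℝ, E) x}
    (hX : MDifferentiableAt 𝓘(ℝ, E) 𝓘(ℝ, E).tangent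
      (fun x => (⟨x, X x⟩ : TangentBundle 𝓘(ℝ, E) M)) q)
    (hY : MDifferentiableAt 𝓘(ℝ, E) 𝓘(ℝ, E).tangent
      (fun x => (⟨x, Y x⟩ : TangentBundle 𝓘(ℝ, E) M)) q)
    (h : ∀ᶠ x in 𝓝 q, X x = Y x) : D X q = D Y q :=
  D.isCovariantDerivativeOnUniv.congr_of_eventuallyEq hX hY Filter.univ_mem h

/-- The connection form in the chart at `p`, as a function on the model space. -/
noncomputable def christoffel (D : Connection E M) (p : M) (x : E) : E →L[ℝ] E →L[ℝ] E :=
  ∑ a, ContinuousLinearMap.smulRightL ℝ E E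
      (LinearMap.toContinuousLinearMap ((Module.finBasis ℝ E).coord a)) ∘L
    (toModel p ((chartAt E p).symm x) ∘L
      D (fieldOfModel p fun _ => Module.finBasis ℝ E a) ((chartAt E p).symm x) ∘L
        ofModel p ((chartAt E p).symm x))

theorem christoffel_apply (D : Connection E M) (hq : q ∈ (chartAt E p).source) (u v : E) :
    christoffel D p (chartAt E p q) u v = ∑ a, (Module.finBasis ℝ E).repr v a •
      toModel p q (D (fieldOfModel p fun _ => Module.finBasis ℝ E a) q (ofModel p q u)) := by
  have key : ∀ x : M, x = q → (∑ a, ContinuousLinearMap.smulRightL ℝ E E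
      (LinearMap.toContinuousLinearMap ((Module.finBasis ℝ E).coord a)) ∘L
      (toModel p x ∘L D (fieldOfModel p fun _ => Module.finBasis ℝ E a) x ∘L ofModel p x)) u v
      = ∑ a, (Module.finBasis ℝ E).repr v a •
        toModel p q (D (fieldOfModel p fun _ => Module.finBasis ℝ E a) q (ofModel p q u)) := by
    rintro x rfl
    simp
  exact key _ ((chartAt E p).left_inv hq)

omit [FiniteDimensional ℂ E] in
theorem Connection.sum_smul (D : Connection E M) {ι : Type*} (s : Finset ι) (f : ι → M → ℝ)
    (X : ι → Π x : M, TangentSpace 𝓘(ℝ, E) x)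
    (hX : ∀ i, MDifferentiableAt 𝓘(ℝ, E) 𝓘(ℝ, E).tangent
      (fun x => (⟨x, X i x⟩ : TangentBundle 𝓘(ℝ, E) M)) q)
    (hf : ∀ i, MDifferentiableAt 𝓘(ℝ, E) 𝓘(ℝ, ℝ) (f i) q) (w : TangentSpace 𝓘(ℝ, E) q) :
    D (fun x => ∑ i ∈ s, f i x • X i x) q w
      = ∑ i ∈ s, (f i q • D (X i) q w + dR (f i) q w • X i q) := by
  classical
  induction s using Finset.induction_on with
  | empty =>
    have := congrFun D.zero q
    simp only [Finset.sum_empty]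
    exact congrArg (fun T : TangentSpace 𝓘(ℝ, E) q →L[ℝ] TangentSpace 𝓘(ℝ, E) q => T w) this
  | insert i s hi ih =>
    have h1 : MDifferentiableAt 𝓘(ℝ, E) 𝓘(ℝ, E).tangent
      (fun x => (⟨x, ∑ i ∈ s, f i x • X i x⟩ : TangentBundle 𝓘(ℝ, E) M)) q :=
      MDifferentiableAt.sum_section fun i _ => (hf i).smul_section (hX i)
    have h2 := D.isCovariantDerivativeOnUniv.add ((hf i).smul_section (hX i)) h1
    have h3 := D.isCovariantDerivativeOnUniv.leibniz (hX i) (hf i)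
    have h4 : (fun x => ∑ i ∈ insert i s, f i x • X i x)
        = (f i • X i) + fun x => ∑ i ∈ s, f i x • X i x := by
      funext x
      simp [Finset.sum_insert hi]
    rw [h4, h2, Finset.sum_insert hi, ← ih, h3]
    rfl

/-- The covariant derivative in the chart at `p`. -/
theorem toModel_connection (D : Connection E M) (hq : q ∈ (chartAt E p).source)
    {X : Π x : M, TangentSpace 𝓘(ℝ, E) x}
    (hX : DifferentiableAt ℝ (modelField p X) (chartAt E p q)) (w : TangentSpace 𝓘(ℝ, E) q) :
    toModel p q (D X q w) = fderiv ℝ (modelField p X) (chartAt E p q) (toModel p q w)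
      + christoffel D p (chartAt E p q) (toModel p q w) (toModel p q (X q)) := by
  set b := Module.finBasis ℝ E with hb
  set V : Fin (Module.finrank ℝ E) → Π x : M, TangentSpace 𝓘(ℝ, E) x :=
    fun a => fieldOfModel p fun _ => b a with hV
  set c : Fin (Module.finrank ℝ E) → E →L[ℝ] ℝ :=
    fun a => LinearMap.toContinuousLinearMap (b.coord a) with hc
  set f : Fin (Module.finrank ℝ E) → M → ℝ := fun a x => c a (modelField p X (chartAt E p x))
    with hf
  have hfd : ∀ a, HasMFDerivAt 𝓘(ℝ, E) 𝓘(ℝ, ℝ) (f a) q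
      ((c a ∘L fderiv ℝ (modelField p X) (chartAt E p q)) ∘L toModel p q) := fun a =>
    hasMFDerivAt_comp_chart (k := fun y => c a (modelField p X y)) hq
      ((c a).hasFDerivAt.comp _ hX.hasFDerivAt)
  have hVd : ∀ a, MDifferentiableAt 𝓘(ℝ, E) 𝓘(ℝ, E).tangent
      (fun x => (⟨x, V a x⟩ : TangentBundle 𝓘(ℝ, E) M)) q := fun a =>
    mdifferentiableAt_fieldOfModel hq (differentiableAt_const _)
  -- Near q the field is a combination of coordinate fields; the Leibniz rule splits its covariant
  -- derivative into the derivative of the coefficients and the Christoffel term.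
  have hsum : ∀ᶠ x in 𝓝 q, X x = ∑ a, f a x • V a x := by
    filter_upwards [(chartAt E p).open_source.mem_nhds hq] with x hx
    have h1 : ∑ a, f a x • V a x = ofModel p x (∑ a, f a x • b a) := by
      simp [hV, fieldOfModel]
    have h2 : ∑ a, f a x • b a = toModel p x (X x) := by
      rw [← modelField_chart X hx]
      exact b.sum_repr _
    rw [h1, h2, ofModel_toModel hx]
  have hXd := (mdifferentiableAt_field_iff hq).2 hX
  have hDX : D X q = D (fun x => ∑ a, f a x • V a x) q :=
    D.congr_of_eventuallyEq hXd (MDifferentiableAt.sum_section fun a _ =>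
      (hfd a).mdifferentiableAt.smul_section (hVd a)) hsum
  rw [hDX, D.sum_smul _ f V hVd fun a => (hfd a).mdifferentiableAt]
  rw [christoffel_apply D hq, map_sum, ofModel_toModel hq]
  simp only [map_add, map_smul]
  rw [Finset.sum_add_distrib, add_comm]
  congr 1
  · conv_rhs => rw [← b.sum_repr (fderiv ℝ (modelField p X) (chartAt E p q) (toModel p q w))]
    refine Finset.sum_congr rfl fun a _ => ?_
    have h1 : dR (f a) q = (c a ∘L fderiv ℝ (modelField p X) (chartAt E p q)) ∘L toModel p q :=
      (hfd a).mfderiv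
    rw [h1, hV]
    simp only [fieldOfModel, toModel_ofModel hq]
    rfl
  · refine Finset.sum_congr rfl fun a _ => ?_
    rw [hf]
    simp only [modelField_chart X hq]
    rfl

end Christoffel

/-! ### Torsion, smoothness and curvature of the connection form; parallel frames -/

section ChristoffelProperties

variable {E : Type*} [NormedAddCommGroup E] [NormedSpace ℂ E] [FiniteDimensional ℂ E]
  {M : Type*} [TopologicalSpace M] [ChartedSpace E M] [IsManifold 𝓘(ℂ, E) ω M]

variable {p q : M} {D : Connection E M}

/-- The covariant derivative of a field given in the chart at `p`. -/
theorem toModel_connection_fieldOfModel (D : Connection E M) (hq : q ∈ (chartAt E p).source)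
    {Y : E → E} {Y' : E →L[ℝ] E} (hY : HasFDerivAt Y Y' (chartAt E p q))
    (w : TangentSpace 𝓘(ℝ, E) q) :
    toModel p q (D (fieldOfModel p Y) q w) = Y' (toModel p q w)
      + christoffel D p (chartAt E p q) (toModel p q w) (Y (chartAt E p q)) := by
  have hev := eventually_modelField_fieldOfModel Y hq
  have h1 : DifferentiableAt ℝ (modelField p (fieldOfModel p Y)) (chartAt E p q) :=
    hY.differentiableAt.congr_of_eventuallyEq hev
  rw [toModel_connection D hq h1, hev.fderiv_eq, hY.fderiv, fieldOfModel, toModel_ofModel hq]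

theorem toModel_connection_const (D : Connection E M) (hq : q ∈ (chartAt E p).source) (v : E)
    (w : TangentSpace 𝓘(ℝ, E) q) :
    toModel p q (D (fieldOfModel p fun _ => v) q w)
      = christoffel D p (chartAt E p q) (toModel p q w) v := by
  rw [toModel_connection_fieldOfModel D hq (hasFDerivAt_const v _)]
  simp

omit [FiniteDimensional ℂ E] in
theorem toModel_injective (hq : q ∈ (chartAt E p).source) {u v : TangentSpace 𝓘(ℝ, E) q}
    (h : toModel p q u = toModel p q v) : u = v := by
  rw [← ofModel_toModel hq u, h, ofModel_toModel hq]

/-- Coordinate fields commute, so the torsion evaluated on them is Γ(u)v - Γ(v)u. -/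
theorem christoffel_symm (htorsion : D.torsion = 0) (hq : q ∈ (chartAt E p).source) (u v : E) :
    christoffel D p (chartAt E p q) u v = christoffel D p (chartAt E p q) v u := by
  have hd : ∀ w : E, MDifferentiableAt 𝓘(ℝ, E) 𝓘(ℝ, E).tangent
      (fun x => (⟨x, fieldOfModel p (fun _ => w) x⟩ : TangentBundle 𝓘(ℝ, E) M)) q := fun w =>
    mdifferentiableAt_fieldOfModel hq (differentiableAt_const _)
  have h1 := D.torsion_eq_zero_iff.1 htorsion (hd u) (hd v)
  rw [mlieBracket_fieldOfModel_const u v hq, sub_eq_zero] at h1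
  have h2 := congrArg (toModel p q) h1
  rw [toModel_connection_const D hq, toModel_connection_const D hq] at h2
  simpa [fieldOfModel, toModel_ofModel hq] using h2

/-- Γ(u)v is the covariant derivative of one coordinate field along another. Smoothness of the
connection is applied to globally smooth fields, so the coordinate field is first extended by a
cutoff; locality of the connection removes the cutoff again. -/
theorem contDiffOn_christoffel [T2Space M] (hD : D.ContMDiffCovariantDerivative ∞) (p : M) :
    ContDiffOn ℝ ∞ (christoffel D p) (chartAt E p).target := by
  refine contDiffOn_clm_apply.2 fun u => contDiffOn_clm_apply.2 fun v => ?_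
  intro x hx
  refine ContDiffAt.contDiffWithinAt ?_
  set q := (chartAt E p).symm x with hq'
  have hq : q ∈ (chartAt E p).source := (chartAt E p).map_target hx
  have hxq : chartAt E p q = x := (chartAt E p).right_inv hx
  obtain ⟨X, hX, hXv⟩ := exists_smooth_extension (q := q)
    (smoothFieldOn_fieldOfModel (p := p) (Y := fun _ => v) (U := (chartAt E p).source) subset_rfl
      fun _ _ => contDiffAt_const) (chartAt E p).open_source hq
  have hDX := hD.contMDiff.contMDiff (σ := X) hX q trivial
  have hu : ContMDiffAt 𝓘(ℝ, E) 𝓘(ℝ, E).tangent ∞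
      (fun x => (⟨x, fieldOfModel p (fun _ => u) x⟩ : TangentBundle 𝓘(ℝ, E) M)) q :=
    contMDiffAt_fieldOfModel hq contDiffAt_const
  have h1 := ContMDiffAt.clm_bundle_apply (hDX.contMDiffAt Filter.univ_mem) hu
  have h2 := (contMDiffAt_field_iff (p := p) hq).1 h1
  rw [hxq] at h2
  refine h2.congr_of_eventuallyEq ?_
  have h3 : ∀ᶠ y in 𝓝 x, ∀ᶠ z in 𝓝 ((chartAt E p).symm y), X z = fieldOfModel p (fun _ => v) z :=
    ((chartAt E p).continuousAt_symm hx).eventually (eventually_eventually_nhds.2 hXv)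
  filter_upwards [h3, (chartAt E p).open_target.mem_nhds hx] with y hy hyt
  have hys := (chartAt E p).map_target hyt
  have h4 : D X ((chartAt E p).symm y)
      = D (fieldOfModel p (fun _ => v)) ((chartAt E p).symm y) :=
    D.congr_of_eventuallyEq (hX.mdifferentiableAt isOpen_univ trivial)
      (mdifferentiableAt_fieldOfModel hys (differentiableAt_const _)) hy
  rw [modelField, h4, toModel_connection_const D hys, fieldOfModel, toModel_ofModel hys,
    (chartAt E p).right_inv hyt]

/-- On coordinate fields the bracket term of the curvature vanishes and ∇_a∇_b w becomes dΓ(a)(b)w +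
Γ(a)Γ(b)w, whose antisymmetrization in a and b is the stated expression. -/
theorem christoffel_flat [T2Space M] (hD : D.ContMDiffCovariantDerivative ∞) (hflat : IsFlat D)
    (p : M) {x : E} (hx : x ∈ (chartAt E p).target) (u v : E) :
    fderiv ℝ (christoffel D p) x u v - fderiv ℝ (christoffel D p) x v u
      + (christoffel D p x u * christoffel D p x v - christoffel D p x v * christoffel D p x u)
      = 0 := by
  set q := (chartAt E p).symm x with hq'
  have hq : q ∈ (chartAt E p).source := (chartAt E p).map_target hx
  have hxq : chartAt E p q = x := (chartAt E p).right_inv hx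
  have hs : ∀ w : E, SmoothFieldOn (M := M) (fieldOfModel p (fun _ => w)) (chartAt E p).source :=
    fun w => smoothFieldOn_fieldOfModel subset_rfl fun _ _ => contDiffAt_const
  have hΓ : HasFDerivAt (christoffel D p) (fderiv ℝ (christoffel D p) x) x :=
    (((contDiffOn_christoffel hD p).contDiffAt ((chartAt E p).open_target.mem_nhds hx)
      ).differentiableAt (by simp)).hasFDerivAt
  have key : ∀ a b w : E, toModel p q (D (fun y => D (fieldOfModel p fun _ => w) y
        (fieldOfModel p (fun _ => b) y)) q (fieldOfModel p (fun _ => a) q))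
      = fderiv ℝ (christoffel D p) x a b w + christoffel D p x a (christoffel D p x b w) := by
    intro a b w
    have h1 : ∀ᶠ y in 𝓝 q, D (fieldOfModel p fun _ => w) y (fieldOfModel p (fun _ => b) y)
        = fieldOfModel p (fun z => christoffel D p z b w) y := by
      filter_upwards [(chartAt E p).open_source.mem_nhds hq] with y hy
      refine toModel_injective hy ?_
      rw [toModel_connection_const D hy]
      simp only [fieldOfModel, toModel_ofModel hy]
    have h2 : HasFDerivAt (fun z => christoffel D p z b w)
        (((fderiv ℝ (christoffel D p) x).flip b).flip w) (chartAt E p q) := by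
      rw [hxq]
      have := (hΓ.clm_apply (hasFDerivAt_const b x)).clm_apply (hasFDerivAt_const w x)
      refine this.congr_fderiv ?_
      ext
      simp
    have h3 := mdifferentiableAt_fieldOfModel (p := p) hq h2.differentiableAt
    have h4 : MDifferentiableAt 𝓘(ℝ, E) 𝓘(ℝ, E).tangent
        (fun y => (⟨y, D (fieldOfModel p fun _ => w) y (fieldOfModel p (fun _ => b) y)⟩ :
          TangentBundle 𝓘(ℝ, E) M)) q := by
      refine h3.congr_of_eventuallyEq ?_
      filter_upwards [h1] with y hy
      rw [hy]
    rw [D.congr_of_eventuallyEq h4 h3 h1, toModel_connection_fieldOfModel D hq h2]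
    simp [fieldOfModel, toModel_ofModel hq, hxq]
  ext w
  have h := hflat _ _ _ _ (chartAt E p).open_source (hs u) (hs v) (hs w) q hq
  rw [mlieBracket_fieldOfModel_const u v hq] at h
  have h' := congrArg (toModel p q) h
  simp only [map_sub, map_zero, sub_zero, key] at h'
  simp only [add_apply, sub_apply, zero_apply]
  rw [← h']
  abel

/-- A parallel frame `g` on a ball around the centre of the chart at `p`, with inverse `h`, in
terms of the connection form in this chart. -/
structure IsParallelFrame (D : Connection E M) (p : M) (g h : E → E →L[ℝ] E) (r : ℝ) : Prop where
  pos : 0 < r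
  subset : Metric.ball (chartAt E p p) r ⊆ (chartAt E p).target
  g_center : g (chartAt E p p) = 1
  smooth_g : ContDiffOn ℝ ∞ g (Metric.ball (chartAt E p p) r)
  smooth_h : ContDiffOn ℝ ∞ h (Metric.ball (chartAt E p p) r)
  g_mul_h : ∀ x ∈ Metric.ball (chartAt E p p) r, g x * h x = 1
  h_mul_g : ∀ x ∈ Metric.ball (chartAt E p p) r, h x * g x = 1
  hasFDerivAt_g : ∀ x ∈ Metric.ball (chartAt E p p) r, HasFDerivAt g
    (-((ContinuousLinearMap.mul ℝ (E →L[ℝ] E)).flip (g x) ∘L christoffel D p x)) x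
  hasFDerivAt_h : ∀ x ∈ Metric.ball (chartAt E p p) r, HasFDerivAt h
    (ContinuousLinearMap.mul ℝ (E →L[ℝ] E) (h x) ∘L christoffel D p x) x

/-- The equation dg = -Γg says that every column x ↦ g(x)v is parallel. Since g = 1 at the centre, g
is invertible on a smaller ball, and its inverse satisfies dh = -h(dg)h = hΓ. -/
theorem exists_isParallelFrame [T2Space M] (hD : D.ContMDiffCovariantDerivative ∞)
    (hflat : IsFlat D) (p : M) : ∃ g h r, IsParallelFrame D p g h r := by
  have hp : chartAt E p p ∈ (chartAt E p).target := mem_chart_target E p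
  obtain ⟨r₁, hr₁, hsub, g, hg1, hgs, hg⟩ := exists_fundamental_solution_of_flat
    (chartAt E p).open_target hp (contDiffOn_christoffel hD p)
    fun x hx => christoffel_flat hD hflat p hx
  have hunit : ∀ᶠ x in 𝓝 (chartAt E p p), IsUnit (g x) := by
    refine (hg _ (Metric.mem_ball_self hr₁)).continuousAt.eventually
      (Units.isOpen.mem_nhds ?_)
    rw [hg1]
    exact isUnit_one
  obtain ⟨r₂, hr₂, hu⟩ := Metric.eventually_nhds_iff_ball.1 hunit
  have hb₁ : Metric.ball (chartAt E p p) (min r₁ r₂) ⊆ Metric.ball (chartAt E p p) r₁ :=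
    Metric.ball_subset_ball (min_le_left _ _)
  have hb₂ : Metric.ball (chartAt E p p) (min r₁ r₂) ⊆ Metric.ball (chartAt E p p) r₂ :=
    Metric.ball_subset_ball (min_le_right _ _)
  have hgh : ∀ x ∈ Metric.ball (chartAt E p p) (min r₁ r₂), g x * Ring.inverse (g x) = 1 :=
    fun x hx => Ring.mul_inverse_cancel _ (hu x (hb₂ hx))
  refine ⟨g, fun x => Ring.inverse (g x), min r₁ r₂, lt_min hr₁ hr₂, hb₁.trans hsub, hg1,
    hgs.mono hb₁, fun x hx => ?_, hgh,
    fun x hx => Ring.inverse_mul_cancel _ (hu x (hb₂ hx)), fun x hx => hg x (hb₁ hx),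
    fun x hx => ?_⟩
  · obtain ⟨u, hu'⟩ := hu x (hb₂ hx)
    have h1 : ContDiffAt ℝ ∞ Ring.inverse (g x) := hu' ▸ contDiffAt_ringInverse ℝ u
    exact h1.comp_contDiffWithinAt x (hgs.mono hb₁ x hx)
  · obtain ⟨u, hu'⟩ := hu x (hb₂ hx)
    have h1 : HasFDerivAt Ring.inverse
        (-ContinuousLinearMap.mulLeftRight ℝ (E →L[ℝ] E) ↑u⁻¹ ↑u⁻¹) (g x) :=
      hu' ▸ hasFDerivAt_ringInverse u
    refine (h1.comp x (hg x (hb₁ hx))).congr_fderiv ?_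
    refine ContinuousLinearMap.ext fun w => ?_
    simp [← hu', mul_assoc]

variable {g h : E → E →L[ℝ] E} {r : ℝ}

/-- The open set on which a parallel frame is defined. -/
def frameDomain (E : Type*) [NormedAddCommGroup E] {M : Type*} [TopologicalSpace M]
    [ChartedSpace E M] (p : M) (r : ℝ) : Set M :=
  (chartAt E p).source ∩ chartAt E p ⁻¹' Metric.ball (chartAt E p p) r

omit [NormedSpace ℂ E] [FiniteDimensional ℂ E] [IsManifold 𝓘(ℂ, E) ω M] in
theorem isOpen_frameDomain (p : M) (r : ℝ) : IsOpen (frameDomain E p r) :=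
  (chartAt E p).isOpen_inter_preimage Metric.isOpen_ball

theorem IsParallelFrame.mem_frameDomain (H : IsParallelFrame D p g h r) :
    p ∈ frameDomain E p r :=
  ⟨mem_chart_source E p, Metric.mem_ball_self H.pos⟩

/-- The fields of a parallel frame are parallel. -/
theorem IsParallelFrame.isParallelFieldOn (H : IsParallelFrame D p g h r) (v : E) :
    IsParallelFieldOn D (fieldOfModel p fun x => g x v) (frameDomain E p r) := by
  refine ⟨smoothFieldOn_fieldOfModel (fun q hq => hq.1) fun q hq => ?_, fun q hq => ?_⟩
  · exact ((H.smooth_g.clm_apply contDiffOn_const).contDiffAt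
      (Metric.isOpen_ball.mem_nhds hq.2))
  · refine ContinuousLinearMap.ext fun w => toModel_injective hq.1 ?_
    have h1 := (H.hasFDerivAt_g _ hq.2).clm_apply (hasFDerivAt_const v _)
    rw [toModel_connection_fieldOfModel D hq.1 h1]
    simp

end ChristoffelProperties

/-! ### The conic action in a chart -/

section ActionInChart

variable {E : Type*} [NormedAddCommGroup E] [NormedSpace ℂ E] [FiniteDimensional ℂ E]
  {M : Type*} [TopologicalSpace M] [ChartedSpace E M]

variable {p q : M} {c : ℂ}

omit [FiniteDimensional ℂ E] in
theorem LocalAction.contMDiffAt (φ : LocalAction E M) (h : (c, q) ∈ φ.domain) :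
    ContMDiffAt (𝓘(ℂ, ℂ).prod 𝓘(ℂ, E)) 𝓘(ℂ, E) ω (fun x : ℂ × M => φ.act x.1 x.2) (c, q) :=
  (φ.holomorphic _ h).contMDiffAt (φ.isOpen_domain.mem_nhds h)

omit [FiniteDimensional ℂ E] in
theorem LocalAction.mdifferentiableAt_act (φ : LocalAction E M) (h : (c, q) ∈ φ.domain) :
    MDifferentiableAt 𝓘(ℂ, E) 𝓘(ℂ, E) (φ.act c) q := by
  have h1 : ContMDiffAt 𝓘(ℂ, E) (𝓘(ℂ, ℂ).prod 𝓘(ℂ, E)) ω (fun x : M => (c, x)) q :=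
    contMDiffAt_const.prodMk contMDiffAt_id
  have h2 : ContMDiffAt 𝓘(ℂ, E) 𝓘(ℂ, E) ω (φ.act c) q :=
    ContMDiffAt.comp q (g := fun x : ℂ × M => φ.act x.1 x.2) (φ.contMDiffAt h) h1
  exact h2.mdifferentiableAt (by simp)

omit [FiniteDimensional ℂ E] in
theorem LocalAction.eventually_mem_domain (φ : LocalAction E M) (p : M) :
    ∀ᶠ z : ℂ × M in 𝓝 (1, p), z ∈ φ.domain :=
  φ.isOpen_domain.mem_nhds (φ.one_mem p)

omit [FiniteDimensional ℂ E] in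
theorem LocalAction.tendsto_act (φ : LocalAction E M) (p : M) :
    Filter.Tendsto (fun z : ℂ × M => φ.act z.1 z.2) (𝓝 (1, p)) (𝓝 p) := by
  have := (φ.contMDiffAt (φ.one_mem p)).continuousAt.tendsto
  simpa only [φ.one_act] using this

/-- The action in the chart at `p`. -/
noncomputable def LocalAction.inChart (φ : LocalAction E M) (p : M) (z : ℂ × E) : E :=
  chartAt E p (φ.act z.1 ((chartAt E p).symm z.2))

omit [FiniteDimensional ℂ E] in
theorem LocalAction.inChart_chart (φ : LocalAction E M) (hq : q ∈ (chartAt E p).source) :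
    φ.inChart p (c, chartAt E p q) = chartAt E p (φ.act c q) := by
  rw [inChart, (chartAt E p).left_inv hq]

variable (E) in
omit [NormedSpace ℂ E] [FiniteDimensional ℂ E] in
theorem tendsto_chart_symm (p : M) :
    Filter.Tendsto (chartAt E p).symm (𝓝 (chartAt E p p)) (𝓝 p) := by
  have := ((chartAt E p).continuousAt_symm (mem_chart_target E p)).tendsto
  rwa [(chartAt E p).left_inv (mem_chart_source E p)] at this

variable (E) in
omit [NormedSpace ℂ E] [FiniteDimensional ℂ E] in
theorem tendsto_prod_chart_symm (p : M) :
    Filter.Tendsto (fun z : ℂ × E => (z.1, (chartAt E p).symm z.2)) (𝓝 (1, chartAt E p p))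
      (𝓝 (1, p)) :=
  (continuous_fst.tendsto ((1 : ℂ), chartAt E p p)).prodMk_nhds
    ((tendsto_chart_symm E p).comp (continuous_snd.tendsto ((1 : ℂ), chartAt E p p)))

variable (E) in
omit [NormedSpace ℂ E] [FiniteDimensional ℂ E] in
theorem tendsto_prod_chart (p : M) :
    Filter.Tendsto (fun z : ℂ × M => (z.1, chartAt E p z.2)) (𝓝 (1, p))
      (𝓝 (1, chartAt E p p)) :=
  (continuous_fst.tendsto ((1 : ℂ), p)).prodMk_nhds
    (((chartAt E p).continuousAt (mem_chart_source E p)).tendsto.comp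
      (continuous_snd.tendsto ((1 : ℂ), p)))

variable [IsManifold 𝓘(ℂ, E) ω M]

omit [FiniteDimensional ℂ E] in
theorem LocalAction.contDiffAt_inChart (φ : LocalAction E M) (p : M) :
    ContDiffAt ℂ 2 (φ.inChart p) (1, chartAt E p p) := by
  have hs : ContMDiffAt 𝓘(ℂ, E) 𝓘(ℂ, E) ω (chartAt E p).symm (chartAt E p p) :=
    (contMDiffOn_chart_symm _ (mem_chart_target E p)).contMDiffAt
      ((chartAt E p).open_target.mem_nhds (mem_chart_target E p))
  have hc : ContMDiffAt 𝓘(ℂ, E) 𝓘(ℂ, E) ω (chartAt E p) p :=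
    (contMDiffOn_chart _ (mem_chart_source E p)).contMDiffAt
      ((chartAt E p).open_source.mem_nhds (mem_chart_source E p))
  have h1 : ContMDiffAt 𝓘(ℂ, ℂ × E) 𝓘(ℂ, ℂ) ω (Prod.fst : ℂ × E → ℂ) (1, chartAt E p p) :=
    contDiffAt_fst.contMDiffAt
  have h2 : ContMDiffAt 𝓘(ℂ, ℂ × E) 𝓘(ℂ, E) ω (Prod.snd : ℂ × E → E) (1, chartAt E p p) :=
    contDiffAt_snd.contMDiffAt
  have h3 : ContMDiffAt 𝓘(ℂ, ℂ × E) (𝓘(ℂ, ℂ).prod 𝓘(ℂ, E)) ω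
      (fun z : ℂ × E => (z.1, (chartAt E p).symm z.2)) (1, chartAt E p p) :=
    h1.prodMk (ContMDiffAt.comp (1, chartAt E p p) hs h2)
  have hp : (chartAt E p).symm (chartAt E p p) = p := (chartAt E p).left_inv (mem_chart_source E p)
  have h4 : ContMDiffAt 𝓘(ℂ, ℂ × E) 𝓘(ℂ, E) ω
      (fun z : ℂ × E => φ.act z.1 ((chartAt E p).symm z.2)) (1, chartAt E p p) :=
    ContMDiffAt.comp (1, chartAt E p p) (g := fun x : ℂ × M => φ.act x.1 x.2)
      (f := fun z : ℂ × E => (z.1, (chartAt E p).symm z.2))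
      (by rw [hp]; exact φ.contMDiffAt (φ.one_mem p)) h3
  have h5 : ContMDiffAt 𝓘(ℂ, ℂ × E) 𝓘(ℂ, E) ω (φ.inChart p) (1, chartAt E p p) :=
    ContMDiffAt.comp (1, chartAt E p p) (g := chartAt E p)
      (f := fun z : ℂ × E => φ.act z.1 ((chartAt E p).symm z.2))
      (by simpa only [hp, φ.one_act] using hc) h4
  exact h5.contDiffAt.of_le le_top

theorem norm_cos_arg_add {F : Type*} [NormedAddCommGroup F] [NormedSpace ℂ F] (c : ℂ) (v : F) :
    (‖c‖ * Real.cos c.arg) • v + (‖c‖ * Real.sin c.arg) • (Complex.I • v) = c • v := by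
  rw [Complex.norm_mul_cos_arg, Complex.norm_mul_sin_arg]
  conv_rhs => rw [← Complex.re_add_im c, add_smul, mul_smul]
  simp [Complex.coe_smul]

/-- This transfers the geometric hypotheses to the chart, where they become calculus on E. -/
theorem LocalAction.isConicModel {φ : LocalAction E M} {D : Connection E M} (hφ : φ.IsConic D)
    (htorsion : D.torsion = 0) {g h : E → E →L[ℝ] E} {r : ℝ} (H : IsParallelFrame D p g h r) :
    IsConicModel (christoffel D p) g h (φ.inChart p) (chartAt E p p) := by
  have hball := Metric.ball_mem_nhds (chartAt E p p) H.pos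
  have htarget := (chartAt E p).open_target.mem_nhds (mem_chart_target E p)
  have hsrc := (chartAt E p).open_source.mem_nhds (mem_chart_source E p)
  refine ⟨?_, ?_, ?_, ?_, φ.contDiffAt_inChart p, ?_, ?_, ?_⟩
  · filter_upwards [hball] with x hx using H.hasFDerivAt_g x hx
  · filter_upwards [hball] with x hx using H.hasFDerivAt_h x hx
  · filter_upwards [hball] with x hx using H.g_mul_h x hx
  · filter_upwards [htarget] with x hx u v
    have := christoffel_symm htorsion ((chartAt E p).map_target hx) u v
    rwa [(chartAt E p).right_inv hx] at this
  · filter_upwards [htarget] with x hx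
    rw [LocalAction.inChart, φ.one_act, (chartAt E p).right_inv hx]
  · have e1 : Filter.Tendsto (fun z : ℂ × ℂ × E => (z.2.1, (chartAt E p).symm z.2.2))
        (𝓝 (1, 1, chartAt E p p)) (𝓝 (1, p)) :=
      (tendsto_prod_chart_symm E p).comp (continuous_snd.tendsto ((1 : ℂ), (1 : ℂ), chartAt E p p))
    have e2 : Filter.Tendsto (fun z : ℂ × ℂ × E => φ.act z.2.1 ((chartAt E p).symm z.2.2))
        (𝓝 (1, 1, chartAt E p p)) (𝓝 p) := (φ.tendsto_act p).comp e1
    have e3 : Filter.Tendsto (fun z : ℂ × ℂ × E => (z.1, φ.act z.2.1 ((chartAt E p).symm z.2.2)))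
        (𝓝 (1, 1, chartAt E p p)) (𝓝 (1, p)) :=
      (continuous_fst.tendsto ((1 : ℂ), (1 : ℂ), chartAt E p p)).prodMk_nhds e2
    have e4 : Filter.Tendsto (fun z : ℂ × ℂ × E => (z.1 * z.2.1, (chartAt E p).symm z.2.2))
        (𝓝 (1, 1, chartAt E p p)) (𝓝 (1, p)) := by
      refine Filter.Tendsto.prodMk_nhds ?_ (Filter.Tendsto.snd_nhds e1)
      have : Continuous fun z : ℂ × ℂ × E => z.1 * z.2.1 := by fun_prop
      simpa using this.tendsto ((1 : ℂ), (1 : ℂ), chartAt E p p)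
    filter_upwards [e1.eventually (φ.eventually_mem_domain p),
      e3.eventually (φ.eventually_mem_domain p), e4.eventually (φ.eventually_mem_domain p),
      e2.eventually hsrc] with z h1 h3 h4 h2
    rw [LocalAction.inChart, LocalAction.inChart, LocalAction.inChart]
    simp only
    rw [(chartAt E p).left_inv h2, φ.mul_act _ _ _ h1 h3 h4]
  -- The conic condition gives a neighbourhood that depends on the parallel field. Finitely many
  -- frame fields share one, and linearity then covers all v.
  · have hb : ∀ a, ∀ᶠ z : ℂ × M in 𝓝 (1, p), _ := fun a =>
      hφ _ _ (isOpen_frameDomain p r) (H.isParallelFieldOn (Module.finBasis ℝ E a)) p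
        H.mem_frameDomain
    have hdiff : ∀ᶠ z : ℂ × E in 𝓝 (1, chartAt E p p), DifferentiableAt ℂ (φ.inChart p) z :=
      ((φ.contDiffAt_inChart p).eventually (by simp)).mono
        fun z hz => hz.differentiableAt (by norm_num)
    filter_upwards [(tendsto_prod_chart_symm E p).eventually (Filter.eventually_all.2 hb),
      (tendsto_prod_chart_symm E p).eventually (φ.eventually_mem_domain p),
      (tendsto_prod_chart_symm E p).eventually ((φ.tendsto_act p).eventually hsrc),
      (continuous_snd.tendsto ((1 : ℂ), chartAt E p p)).eventually htarget, hdiff]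
      with ⟨c, x⟩ h1 h2 h3 h4 h5 v
    simp only at h1 h2 h3 h4
    set q := (chartAt E p).symm x with hq'
    have hq : q ∈ (chartAt E p).source := (chartAt E p).map_target h4
    have hxq : chartAt E p q = x := (chartAt E p).right_inv h4
    have hF : HasFDerivAt (fun y => φ.inChart p (c, y))
        (fderiv ℝ (fun y => φ.inChart p (c, y)) (chartAt E p q)) (chartAt E p q) := by
      rw [hxq]
      have : DifferentiableAt ℝ (fun y => φ.inChart p (c, y)) x :=
        DifferentiableAt.comp (g := φ.inChart p) (f := fun y : E => (c, y)) x
          (h5.restrictScalars ℝ) (by fun_prop)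
      exact this.hasFDerivAt
    have hA := hasMFDerivAt_comp_chart hq hF
    have hact := (hasMFDerivAt_restrictScalars (φ.mdifferentiableAt_act h2)).mdifferentiableAt
    have hB := (hasMFDerivAt_chart h3).comp q hact.hasMFDerivAt
    have hAB : (fun y => φ.inChart p (c, chartAt E p y)) =ᶠ[𝓝 q] chartAt E p ∘ φ.act c := by
      filter_upwards [(chartAt E p).open_source.mem_nhds hq] with y hy
      exact φ.inChart_chart hy
    have huniq := hasMFDerivAt_unique hA (hB.congr_of_eventuallyEq hAB)
    have hv : ∀ v : TangentSpace 𝓘(ℝ, E) q,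
        fderiv ℝ (fun y => φ.inChart p (c, y)) x (toModel p q v)
          = toModel p (φ.act c q) (mfderiv 𝓘(ℝ, E) 𝓘(ℝ, E) (φ.act c) q v) := by
      intro v
      have := congrArg (fun T : TangentSpace 𝓘(ℝ, E) q →L[ℝ] E => T v) huniq
      rw [← hxq]
      exact this
    have hΦ : φ.inChart p (c, x) = chartAt E p (φ.act c q) := rfl
    have hbasis : ∀ a, fderiv ℝ (fun y => φ.inChart p (c, y)) x (g x (Module.finBasis ℝ E a))
        = c • g (φ.inChart p (c, x)) (Module.finBasis ℝ E a) := by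
      intro a
      have h6 := congrArg (toModel p (φ.act c q)) (h1 a)
      rw [← hv] at h6
      simp only [map_add, map_smul, toModel_J h3] at h6
      simp only [fieldOfModel, toModel_ofModel h3, toModel_ofModel hq, hxq] at h6
      rw [h6, norm_cos_arg_add, hΦ]
    have hlin : (fderiv ℝ (fun y => φ.inChart p (c, y)) x ∘L g x : E →ₗ[ℝ] E)
        = ((c • ContinuousLinearMap.id ℂ E).restrictScalars ℝ ∘L g (φ.inChart p (c, x)) :
          E →L[ℝ] E) :=
      (Module.finBasis ℝ E).ext fun a => by simpa using hbasis a
    have := congrArg (fun T : E →ₗ[ℝ] E => T v) hlin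
    simpa using this

end ActionInChart

/-! ### Local diffeomorphisms from invertible derivatives -/

section LocalDiffeomorph

variable {𝕜 : Type*} [RCLike 𝕜] {E : Type*} [NormedAddCommGroup E] [NormedSpace 𝕜 E]
  {F : Type*} [NormedAddCommGroup F] [NormedSpace 𝕜 F] {n : WithTop ℕ∞}

/-- The inverse function theorem: a map with invertible derivatives is a local diffeomorphism. -/
theorem isLocalDiffeomorphAt_of_hasFDerivAt_equiv [CompleteSpace E] {k : E → F} {s : Set E} {x₀ : E}
    (hs : IsOpen s) (hx₀ : x₀ ∈ s) (hk : ContDiffOn 𝕜 n k s) (hn : n ≠ 0)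
    (hk' : ∀ x ∈ s, ∃ e : E ≃L[𝕜] F, HasFDerivAt k (e : E →L[𝕜] F) x) :
    IsLocalDiffeomorphAt 𝓘(𝕜, E) 𝓘(𝕜, F) n k x₀ := by
  obtain ⟨e, he⟩ := hk' x₀ hx₀
  have hk₀ : ContDiffAt 𝕜 n k x₀ := hk.contDiffAt (hs.mem_nhds hx₀)
  -- The restriction to s makes the derivative invertible at every source point, so that the inverse
  -- is of class Cⁿ on the whole target and not only at the image of x₀.
  set Φ := (hk₀.toOpenPartialHomeomorph k he hn).restrOpen s hs with hΦ
  have hΦs : Φ.source ⊆ s := fun x hx => hx.2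
  refine ⟨⟨Φ.toPartialEquiv, Φ.open_source, Φ.open_target, ?_, ?_⟩, ?_, fun x _ => rfl⟩
  · exact (hk.mono hΦs).contMDiffOn
  · refine ContDiffOn.contMDiffOn fun y hy => ContDiffAt.contDiffWithinAt ?_
    have hy' := hΦs (Φ.map_target hy)
    obtain ⟨e', he'⟩ := hk' _ hy'
    exact Φ.contDiffAt_symm hy he' (hk.contDiffAt (hs.mem_nhds hy'))
  · exact ⟨ContDiffAt.mem_toOpenPartialHomeomorph_source hk₀ he hn, hx₀⟩

variable {M : Type*} [TopologicalSpace M] [ChartedSpace E M]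

theorem isLocalDiffeomorphAt_chart [IsManifold 𝓘(𝕜, E) n M] (p : M) :
    IsLocalDiffeomorphAt 𝓘(𝕜, E) 𝓘(𝕜, E) n (chartAt E p) p :=
  ⟨⟨(chartAt E p).toPartialEquiv, (chartAt E p).open_source, (chartAt E p).open_target,
    contMDiffOn_chart, contMDiffOn_chart_symm⟩, mem_chart_source E p, fun _ _ => rfl⟩

theorem isLocalDiffeomorphAt_comp_chart [CompleteSpace E] [IsManifold 𝓘(𝕜, E) n M] {p : M}
    {k : E → F} {s : Set E} (hs : IsOpen s) (hp : chartAt E p p ∈ s) (hk : ContDiffOn 𝕜 n k s)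
    (hn : n ≠ 0) (hk' : ∀ x ∈ s, ∃ e : E ≃L[𝕜] F, HasFDerivAt k (e : E →L[𝕜] F) x) :
    IsLocalDiffeomorphAt 𝓘(𝕜, E) 𝓘(𝕜, F) n (fun q : M => k (chartAt E p q)) p :=
  IsLocalDiffeomorphAt.comp (hf := isLocalDiffeomorphAt_chart p)
    (hg := isLocalDiffeomorphAt_of_hasFDerivAt_equiv hs hp hk hn hk')

end LocalDiffeomorph

/-! ### The potentials as affine, homogeneous functions on the manifold -/

section ConicPotential

variable {E : Type*} [NormedAddCommGroup E] [NormedSpace ℂ E] [FiniteDimensional ℂ E]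
  {M : Type*} [TopologicalSpace M] [ChartedSpace E M] [IsManifold 𝓘(ℂ, E) ω M]

variable {p q : M} {D : Connection E M} {g h : E → E →L[ℝ] E} {r : ℝ} {Φ : ℂ × E → E}
  {φ : LocalAction E M}

omit [FiniteDimensional ℂ E] in
theorem mdifferentiableAt_comp_chart {F : Type*} [NormedAddCommGroup F] [NormedSpace ℂ F]
    {k : E → F} (hq : q ∈ (chartAt E p).source) (hk : DifferentiableAt ℂ k (chartAt E p q)) :
    MDifferentiableAt 𝓘(ℂ, E) 𝓘(ℂ, F) (fun x : M => k (chartAt E p x)) q :=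
  MDifferentiableAt.comp q hk.mdifferentiableAt
    ((mdifferentiable_chart (I := 𝓘(ℂ, E)) p).mdifferentiableAt hq)

/-- The function on `M` given by `potential` in the chart at `p`. -/
noncomputable def chartPotential (p : M) (h : E → E →L[ℝ] E) (Φ : ℂ × E → E) (T : E →L[ℝ] ℝ)
    (q : M) : ℂ :=
  potential h Φ T (chartAt E p q)

/-- The radius `r` is so small that the derivative of the potentials is known. -/
def HasPotentials (h : E → E →L[ℝ] E) (Φ : ℂ × E → E) (x₀ : E) (r : ℝ) : Prop :=
  ∀ x ∈ Metric.ball x₀ r, ∀ T : E →L[ℝ] ℝ,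
    HasFDerivAt (potential h Φ T) (complexifyFunctional (T ∘L h x)) x

theorem IsParallelFrame.mono (H : IsParallelFrame D p g h r) {r' : ℝ} (hr' : 0 < r')
    (hr : r' ≤ r) : IsParallelFrame D p g h r' :=
  have hb := Metric.ball_subset_ball (x := chartAt E p p) hr
  ⟨hr', hb.trans H.subset, H.g_center, H.smooth_g.mono hb, H.smooth_h.mono hb,
    fun x hx => H.g_mul_h x (hb hx), fun x hx => H.h_mul_g x (hb hx),
    fun x hx => H.hasFDerivAt_g x (hb hx), fun x hx => H.hasFDerivAt_h x (hb hx)⟩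

theorem exists_hasPotentials [T2Space M] (hD : D.ContMDiffCovariantDerivative ∞)
    (hflat : IsFlat D) (htorsion : D.torsion = 0) (hφ : φ.IsConic D) (p : M) :
    ∃ g h r, IsParallelFrame D p g h r ∧ HasPotentials h (φ.inChart p) (chartAt E p p) r := by
  obtain ⟨g, h, r, H⟩ := exists_isParallelFrame hD hflat p
  obtain ⟨r', hr', hP⟩ := Metric.eventually_nhds_iff_ball.1
    (LocalAction.isConicModel hφ htorsion H).hasFDerivAt_potential
  exact ⟨g, h, min r r', H.mono (lt_min H.pos hr') (min_le_left _ _),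
    fun x hx => hP x (Metric.ball_subset_ball (min_le_right _ _) hx)⟩

theorem holomorphicNear_chartPotential (H : IsParallelFrame D p g h r)
    (hP : HasPotentials h Φ (chartAt E p p) r) (T : E →L[ℝ] ℝ) :
    HolomorphicNear (E := E) (chartPotential p h Φ T) p := by
  filter_upwards [(isOpen_frameDomain p r).mem_nhds H.mem_frameDomain] with q hq
  exact mdifferentiableAt_comp_chart hq.1 (hP _ hq.2 T).differentiableAt

theorem homogeneousNear_chartPotential (hφ : φ.IsConic D) (htorsion : D.torsion = 0)
    (H : IsParallelFrame D p g h r) (T : E →L[ℝ] ℝ) :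
    HomogeneousNear φ (chartPotential p h (φ.inChart p) T) p := by
  filter_upwards [(tendsto_prod_chart E p).eventually
      (LocalAction.isConicModel hφ htorsion H).potential_act,
    (continuous_snd.tendsto ((1 : ℂ), p)).eventually
      ((chartAt E p).open_source.mem_nhds (mem_chart_source E p))] with ⟨c, q⟩ h1 h2
  have := h1 T
  simp only [φ.inChart_chart h2] at this
  exact this

omit [FiniteDimensional ℂ E] in
theorem hasFDerivAt_potential_re {x₀ x : E} (hP : HasPotentials h Φ x₀ r) (T : E →L[ℝ] ℝ)
    (hx : x ∈ Metric.ball x₀ r) :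
    HasFDerivAt (fun x => (potential h Φ T x).re) (T ∘L h x) x := by
  refine (Complex.reCLM.hasFDerivAt.comp x ((hP x hx T).restrictScalars ℝ)).congr_fderiv ?_
  ext v
  exact complexifyFunctional_re _ v

theorem contDiffOn_potential_re (H : IsParallelFrame D p g h r)
    (hP : HasPotentials h Φ (chartAt E p p) r) (T : E →L[ℝ] ℝ) :
    ContDiffOn ℝ ∞ (fun x => (potential h Φ T x).re) (Metric.ball (chartAt E p p) r) := by
  refine (contDiffOn_infty_iff_fderiv_of_isOpen Metric.isOpen_ball).2 ⟨fun x hx =>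
    (hasFDerivAt_potential_re hP T hx).differentiableAt.differentiableWithinAt, ?_⟩
  exact (contDiffOn_const.clm_comp H.smooth_h).congr fun x hx =>
    (hasFDerivAt_potential_re hP T hx).fderiv

omit [FiniteDimensional ℂ E] in
theorem dR_chartPotential_re (hP : HasPotentials h Φ (chartAt E p p) r) (T : E →L[ℝ] ℝ)
    (hq : q ∈ frameDomain E p r) :
    dR (fun q => (chartPotential p h Φ T q).re) q = (T ∘L h (chartAt E p q)) ∘L toModel p q :=
  dR_of_eventuallyEq_comp_chart (k := fun x => (potential h Φ T x).re) hq.1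
    (hasFDerivAt_potential_re hP T hq.2) (Filter.Eventually.of_forall fun _ => rfl)

/-- The differential is T∘h, a row of the parallel coframe. From dh = hΓ one gets d(T(hY)) = T(h(dY
+ ΓY)) = T(h∇Y), which is the vanishing of ∇df. -/
theorem isAffineOn_chartPotential_re (H : IsParallelFrame D p g h r)
    (hP : HasPotentials h Φ (chartAt E p p) r) (T : E →L[ℝ] ℝ) :
    IsAffineOn D (fun q => (chartPotential p h Φ T q).re) (frameDomain E p r) := by
  refine ⟨fun q hq => ContMDiffAt.contMDiffWithinAt ?_, fun Y hY q hq w => ?_⟩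
  · refine (contMDiffAt_iff_model hq.1).2 ?_
    refine ((contDiffOn_potential_re H hP T).contDiffAt
      (Metric.isOpen_ball.mem_nhds hq.2)).congr_of_eventuallyEq ?_
    filter_upwards [(chartAt E p).open_target.mem_nhds ((chartAt E p).map_source hq.1)] with x hx
    simp [chartPotential, (chartAt E p).right_inv hx]
  · have hYd : DifferentiableAt ℝ (modelField p Y) (chartAt E p q) :=
      (mdifferentiableAt_field_iff hq.1).1 (hY.mdifferentiableAt (isOpen_frameDomain p r) hq)
    have hk := T.hasFDerivAt.comp _ ((H.hasFDerivAt_h _ hq.2).clm_apply hYd.hasFDerivAt)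
    rw [dR_of_eventuallyEq_comp_chart hq.1 hk (f := fun y =>
      dR (fun q => (chartPotential p h Φ T q).re) y (Y y)) ?_, dR_chartPotential_re hP T hq]
    · simp [toModel_connection D hq.1 hYd w, modelField_chart Y hq.1]
    · filter_upwards [(isOpen_frameDomain p r).mem_nhds hq] with y hy
      rw [dR_chartPotential_re hP T hy]
      simp [modelField_chart Y hy.1]

end ConicPotential

/-! ### Affine, real special and holomorphic coordinates from potentials -/

section Coordinates

variable {E : Type*} [NormedAddCommGroup E] [NormedSpace ℂ E] [FiniteDimensional ℂ E]
  {M : Type*} [TopologicalSpace M] [ChartedSpace E M] [IsManifold 𝓘(ℂ, E) ω M]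

variable {p q : M} {D : Connection E M} {g h : E → E →L[ℝ] E} {r : ℝ} {Φ : ℂ × E → E}
  {φ : LocalAction E M} {n : ℕ}

omit [FiniteDimensional ℂ E] in
/-- A function with vanishing derivative is locally constant. -/
theorem eventually_eq_of_dR_eq_zero {F : Type*} [NormedAddCommGroup F] [NormedSpace ℝ F]
    {f : M → F} (hf : ∀ᶠ q in 𝓝 p, MDifferentiableAt 𝓘(ℝ, E) 𝓘(ℝ, F) f q ∧
      ∀ v : TangentSpace 𝓘(ℝ, E) q, dR f q v = 0) : ∀ᶠ q in 𝓝 p, f q = f p := by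
  have htarget := (chartAt E p).open_target.mem_nhds (mem_chart_target E p)
  obtain ⟨r, hr, hb⟩ := Metric.eventually_nhds_iff_ball.1
    (((tendsto_chart_symm E p).eventually hf).and htarget)
  have hder : ∀ x ∈ Metric.ball (chartAt E p p) r,
      HasFDerivAt (f ∘ (chartAt E p).symm) (0 : E →L[ℝ] F) x := by
    intro x hx
    obtain ⟨⟨hd, h0⟩, hxt⟩ := hb x hx
    have hq := (chartAt E p).map_target hxt
    have hd' := (mdifferentiableAt_iff_model hq).1 hd
    have heq := dR_of_eventuallyEq_comp_chart hq hd'.hasFDerivAt (f := f) (by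
      filter_upwards [(chartAt E p).open_source.mem_nhds hq] with y hy
      simp [(chartAt E p).left_inv hy])
    rw [(chartAt E p).right_inv hxt] at heq hd'
    refine hd'.hasFDerivAt.congr_fderiv (ContinuousLinearMap.ext fun v => ?_)
    have h1 := h0 (ofModel p _ v)
    rw [heq, ContinuousLinearMap.comp_apply, toModel_ofModel hq] at h1
    exact h1
  have hconst : ∀ x ∈ Metric.ball (chartAt E p p) r,
      f ((chartAt E p).symm x) = f ((chartAt E p).symm (chartAt E p p)) := fun x hx =>
    Metric.isOpen_ball.is_const_of_fderiv_eq_zero (𝕜 := ℝ)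
      (convex_ball (chartAt E p p) r).isPreconnected
      (fun y hy => (hder y hy).differentiableAt.differentiableWithinAt)
      (fun y hy => (hder y hy).fderiv) hx (Metric.mem_ball_self hr)
  filter_upwards [(chartAt E p).open_source.mem_nhds (mem_chart_source E p),
    ((chartAt E p).continuousAt (mem_chart_source E p)).eventually
      (Metric.ball_mem_nhds _ hr)] with q hq hqb
  have := hconst _ hqb
  rwa [(chartAt E p).left_inv hq, (chartAt E p).left_inv (mem_chart_source E p)] at this

/-- The first components of real linear coordinates. -/
noncomputable def fstFunctional (L : E ≃ₗ[ℝ] (Fin n → ℝ) × (Fin n → ℝ)) (i : Fin n) : E →L[ℝ] ℝ :=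
  LinearMap.toContinuousLinearMap
    (LinearMap.proj i ∘ₗ LinearMap.fst ℝ (Fin n → ℝ) (Fin n → ℝ) ∘ₗ (L : E →ₗ[ℝ] _))

/-- The second components of real linear coordinates. -/
noncomputable def sndFunctional (L : E ≃ₗ[ℝ] (Fin n → ℝ) × (Fin n → ℝ)) (i : Fin n) : E →L[ℝ] ℝ :=
  LinearMap.toContinuousLinearMap
    (LinearMap.proj i ∘ₗ LinearMap.snd ℝ (Fin n → ℝ) (Fin n → ℝ) ∘ₗ (L : E →ₗ[ℝ] _))

theorem fstFunctional_apply (L : E ≃ₗ[ℝ] (Fin n → ℝ) × (Fin n → ℝ)) (i : Fin n) (v : E) :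
    fstFunctional L i v = (L v).1 i := rfl

theorem sndFunctional_apply (L : E ≃ₗ[ℝ] (Fin n → ℝ) × (Fin n → ℝ)) (i : Fin n) (v : E) :
    sndFunctional L i v = (L v).2 i := rfl

/-- The inverse of a parallel frame as an equivalence. -/
noncomputable def IsParallelFrame.coframe (H : IsParallelFrame D p g h r) {x : E}
    (hx : x ∈ Metric.ball (chartAt E p p) r) : E ≃L[ℝ] E :=
  ContinuousLinearEquiv.equivOfInverse (h x) (g x)
    (fun v => congrArg (fun T : E →L[ℝ] E => T v) (H.g_mul_h x hx))
    (fun v => congrArg (fun T : E →L[ℝ] E => T v) (H.h_mul_g x hx))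

/-- The potentials of real linear coordinates have the properties (a) and (b). -/
theorem areConicFunctionsNear_chartPotential (hφ : φ.IsConic D) (htorsion : D.torsion = 0)
    (H : IsParallelFrame D p g h r) (hP : HasPotentials h (φ.inChart p) (chartAt E p p) r)
    (L : E ≃ₗ[ℝ] (Fin n → ℝ) × (Fin n → ℝ)) :
    AreConicFunctionsNear D φ (fun i => chartPotential p h (φ.inChart p) (fstFunctional L i))
      (fun i => chartPotential p h (φ.inChart p) (sndFunctional L i)) p := by
  refine ⟨fun i => holomorphicNear_chartPotential H hP _,
    fun i => holomorphicNear_chartPotential H hP _,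
    fun i => homogeneousNear_chartPotential hφ htorsion H _,
    fun i => homogeneousNear_chartPotential hφ htorsion H _, ?_, frameDomain E p r,
    isOpen_frameDomain p r, H.mem_frameDomain, fun i => isAffineOn_chartPotential_re H hP _,
    fun i => isAffineOn_chartPotential_re H hP _⟩
  have hM : IsManifold 𝓘(ℝ, E) ∞ M := IsManifold.of_le (n := ω) le_top
  have : CompleteSpace E := FiniteDimensional.complete ℂ E
  -- The derivative of the coordinate map at x is L∘h(x), which is invertible at every point of the
  -- ball.
  refine isLocalDiffeomorphAt_comp_chart (𝕜 := ℝ) (s := Metric.ball (chartAt E p p) r)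
    (k := fun x => ((fun i => (potential h (φ.inChart p) (fstFunctional L i) x).re,
      fun i => (potential h (φ.inChart p) (sndFunctional L i) x).re) :
        (Fin n → ℝ) × (Fin n → ℝ))) Metric.isOpen_ball (Metric.mem_ball_self H.pos)
    ?_ (by simp) fun x hx => ⟨(H.coframe hx).trans L.toContinuousLinearEquiv, ?_⟩
  · exact (contDiffOn_pi.2 fun i => contDiffOn_potential_re H hP _).prodMk
      (contDiffOn_pi.2 fun i => contDiffOn_potential_re H hP _)
  · refine ((hasFDerivAt_pi.2 fun i => hasFDerivAt_potential_re hP (fstFunctional L i) hx).prodMk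
      (hasFDerivAt_pi.2 fun i => hasFDerivAt_potential_re hP (sndFunctional L i) hx)).congr_fderiv
        ?_
    rfl

omit [FiniteDimensional ℂ E] in
theorem mdifferentiableAt_form_apply {α : BilinField E M} (hα : IsSymplectic α)
    {X Y : Π x : M, TangentSpace 𝓘(ℝ, E) x}
    (hX : MDifferentiableAt 𝓘(ℝ, E) 𝓘(ℝ, E).tangent
      (fun x => (⟨x, X x⟩ : TangentBundle 𝓘(ℝ, E) M)) q)
    (hY : MDifferentiableAt 𝓘(ℝ, E) 𝓘(ℝ, E).tangent
      (fun x => (⟨x, Y x⟩ : TangentBundle 𝓘(ℝ, E) M)) q) :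
    MDifferentiableAt 𝓘(ℝ, E) 𝓘(ℝ, ℝ) (fun x => α x (X x) (Y x)) q := by
  have hα' : MDifferentiableAt 𝓘(ℝ, E) (𝓘(ℝ, E).prod 𝓘(ℝ, E →L[ℝ] E →L[ℝ] ℝ))
      (fun x => Bundle.TotalSpace.mk' (E →L[ℝ] E →L[ℝ] ℝ)
      (E := fun x : M => TangentSpace 𝓘(ℝ, E) x →L[ℝ] TangentSpace 𝓘(ℝ, E) x →L[ℝ]
        (Bundle.Trivial M ℝ) x) x (α x)) q :=
    hα.smooth.mdifferentiableAt (by simp)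
  have := MDifferentiableAt.clm_bundle_apply₂ (F₁ := E) (F₂ := E) (E₃ := Bundle.Trivial M ℝ)
    (F₃ := ℝ) hα' hX hY
  simp only [mdifferentiableAt_totalSpace] at this
  exact this.2

/-- The value at `q` of a field of bilinear forms, in the chart at `p`. -/
noncomputable def modelForm (α : BilinField E M) (p q : M) : E →ₗ[ℝ] E →ₗ[ℝ] ℝ :=
  LinearMap.mk₂ ℝ (fun s t => α q (ofModel p q s) (ofModel p q t)) (by simp) (by simp) (by simp)
    (by simp)

omit [FiniteDimensional ℂ E] in
theorem modelForm_apply (α : BilinField E M) (p q : M) (s t : E) :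
    modelForm α p q s t = α q (ofModel p q s) (ofModel p q t) := rfl

omit [FiniteDimensional ℂ E] in
theorem modelForm_isAlt {α : BilinField E M} (hα : IsSymplectic α) (p q : M) :
    (modelForm α p q).IsAlt := fun _ => hα.alternating _ _

omit [FiniteDimensional ℂ E] in
theorem modelForm_nondegenerate {α : BilinField E M} (hα : IsSymplectic α)
    (hq : q ∈ (chartAt E p).source) (v : E) (hv : ∀ w, modelForm α p q v w = 0) : v = 0 := by
  have h1 : ofModel p q v = 0 := hα.nondegenerate q _ fun w => by
    rw [← ofModel_toModel hq w]
    exact hv _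
  rw [← toModel_ofModel hq v, h1, map_zero]

omit [FiniteDimensional ℂ E] in
theorem modelForm_smul_I {α : BilinField E M} (hα : IsJInvariant α)
    (hq : q ∈ (chartAt E p).source) (u v : E) :
    modelForm α p q (Complex.I • u) (Complex.I • v) = modelForm α p q u v := by
  have h1 : ∀ w : E, ofModel p q (Complex.I • w) = J q (ofModel p q w) := fun w =>
    toModel_injective hq (by rw [toModel_ofModel hq, toModel_J hq, toModel_ofModel hq])
  rw [modelForm_apply, h1, h1, hα, modelForm_apply]

/-- A parallel form is constant in a parallel frame. -/
theorem IsParallelForm.eventually_eq_modelForm {α : BilinField E M} (hpar : IsParallelForm D α)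
    (hα : IsSymplectic α) (H : IsParallelFrame D p g h r) :
    ∀ᶠ q in 𝓝 p, ∀ u v : TangentSpace 𝓘(ℝ, E) q, α q u v =
      modelForm α p p (h (chartAt E p q) (toModel p q u)) (h (chartAt E p q) (toModel p q v)) := by
  set b := Module.finBasis ℝ E
  have hdom := (isOpen_frameDomain p r).mem_nhds H.mem_frameDomain
  have hconst : ∀ i j, ∀ᶠ q in 𝓝 p,
      modelForm α p q (g (chartAt E p q) (b i)) (g (chartAt E p q) (b j))
        = modelForm α p p (g (chartAt E p p) (b i)) (g (chartAt E p p) (b j)) := by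
    intro i j
    refine eventually_eq_of_dR_eq_zero (E := E) (f := fun q =>
      modelForm α p q (g (chartAt E p q) (b i)) (g (chartAt E p q) (b j))) ?_
    filter_upwards [hdom] with q hq
    have hi := H.isParallelFieldOn (b i)
    have hj := H.isParallelFieldOn (b j)
    refine ⟨mdifferentiableAt_form_apply hα (hi.1.mdifferentiableAt (isOpen_frameDomain p r) hq)
      (hj.1.mdifferentiableAt (isOpen_frameDomain p r) hq), fun v => ?_⟩
    have := hpar _ _ _ (isOpen_frameDomain p r) hi.1 hj.1 q hq v
    rw [hi.2 q hq, hj.2 q hq] at this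
    simp only [zero_apply, map_zero, sub_zero] at this
    exact this
  filter_upwards [Filter.eventually_all.2 fun i => Filter.eventually_all.2 (hconst i), hdom]
    with q hq hqd u v
  -- The coefficients of α in the frame are locally constant, and the frame is the identity at p, so
  -- pulling back by g at q gives the form at p.
  have h1 : (modelForm α p q).compl₁₂ (g (chartAt E p q) : E →ₗ[ℝ] E)
      (g (chartAt E p q) : E →ₗ[ℝ] E) = modelForm α p p :=
    LinearMap.ext_basis b b fun i j => by simpa [H.g_center] using hq i j
  have h2 : ∀ w : TangentSpace 𝓘(ℝ, E) q,
      ofModel p q (g (chartAt E p q) (h (chartAt E p q) (toModel p q w))) = w := by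
    intro w
    have := congrArg (fun T : E →L[ℝ] E => T (toModel p q w)) (H.g_mul_h _ hqd.2)
    simp only [mul_apply_eq_comp, one_apply_eq_self] at this
    rw [this, ofModel_toModel hqd.1]
  rw [← h1, LinearMap.compl₁₂_apply]
  simp only [ContinuousLinearMap.coe_coe, modelForm_apply, h2]

/-- The differentials of the coordinates at q are the components of L∘h, and α at q is the pullback
by h of α at p. A normal form for L at p therefore holds at all nearby points. -/
theorem areRealSpecialNear_chartPotential {α : BilinField E M} (hα : IsSymplectic α)
    (hpar : IsParallelForm D α) (hφ : φ.IsConic D) (htorsion : D.torsion = 0)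
    (H : IsParallelFrame D p g h r) (hP : HasPotentials h (φ.inChart p) (chartAt E p p) r)
    {L : E ≃ₗ[ℝ] (Fin n → ℝ) × (Fin n → ℝ)} (hL : ∀ u v, modelForm α p p u v =
      2 * ∑ i, ((L u).1 i * (L v).2 i - (L v).1 i * (L u).2 i)) :
    AreRealSpecialNear D α
      (rePart fun i => chartPotential p h (φ.inChart p) (fstFunctional L i))
      (rePart fun i => chartPotential p h (φ.inChart p) (sndFunctional L i)) p := by
  refine ⟨(areConicFunctionsNear_chartPotential hφ htorsion H hP L).affine, ?_⟩
  filter_upwards [hpar.eventually_eq_modelForm hα H,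
    (isOpen_frameDomain p r).mem_nhds H.mem_frameDomain] with q h1 hq u v
  rw [h1, hL]
  have hx : ∀ T : E →L[ℝ] ℝ, ∀ w : TangentSpace 𝓘(ℝ, E) q,
      dR (fun q => (chartPotential p h (φ.inChart p) T q).re) q w
        = T (h (chartAt E p q) (toModel p q w)) := fun T w => by
    rw [dR_chartPotential_re hP T hq]
    rfl
  refine congrArg (fun t : ℝ => 2 * t) (Finset.sum_congr rfl fun i _ => ?_)
  have h2 := hx (fstFunctional L i)
  have h3 := hx (sndFunctional L i)
  simp only [fstFunctional_apply, sndFunctional_apply] at h2 h3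
  rw [← h2, ← h2, ← h3, ← h3]
  rfl

/-- Potentials are holomorphic coordinates if their derivatives at `p` are independent. -/
theorem areHolomorphicCoordinatesNear_chartPotential (H : IsParallelFrame D p g h r)
    (hP : HasPotentials h Φ (chartAt E p p) r) (hn : Module.finrank ℂ E = n)
    (T : Fin n → E →L[ℝ] ℝ) (hT : ∀ v, (∀ i, T i v = 0) → (∀ i, T i (Complex.I • v) = 0) → v = 0) :
    AreHolomorphicCoordinatesNear (E := E) (fun i => chartPotential p h Φ (T i)) p := by
  have hM : IsManifold 𝓘(ℂ, E) 1 M := IsManifold.of_le (n := ω) le_top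
  set x₀ := chartAt E p p with hx₀
  set k' : E → E →L[ℂ] (Fin n → ℂ) := fun x =>
    ContinuousLinearMap.pi fun i => complexifyFunctional (T i ∘L h x) with hk'
  have hder : ∀ x ∈ Metric.ball x₀ r,
      HasFDerivAt (fun x i => potential h Φ (T i) x) (k' x) x := fun x hx =>
    hasFDerivAt_pi.2 fun i => hP x hx (T i)
  -- Continuity of the coframe makes the complex derivative continuous, which is the C¹ condition
  -- over ℂ, and later keeps it invertible near the centre.
  have hcont : ContinuousOn k' (Metric.ball x₀ r) := by
    refine continuousOn_clm_apply.2 fun v => continuousOn_pi.2 fun i => ?_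
    have h1 : ∀ w : E, ContinuousOn (fun x => T i (h x w)) (Metric.ball x₀ r) := fun w =>
      (T i).continuous.comp_continuousOn (H.smooth_h.continuousOn.clm_apply continuousOn_const)
    simp only [hk', ContinuousLinearMap.coe_pi', complexifyFunctional_apply,
      ContinuousLinearMap.comp_apply]
    exact (Complex.continuous_ofReal.comp_continuousOn (h1 v)).sub
      (continuousOn_const.mul (Complex.continuous_ofReal.comp_continuousOn (h1 _)))
  have hcd : ContDiffOn ℂ 1 (fun x i => potential h Φ (T i) x) (Metric.ball x₀ r) :=
    (contDiffOn_succ_iff_fderiv_of_isOpen (n := 0) Metric.isOpen_ball).2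
      ⟨fun x hx => (hder x hx).differentiableAt.differentiableWithinAt, by simp,
        contDiffOn_zero.2 (hcont.congr fun x hx => (hder x hx).fderiv)⟩
  -- At the centre h = 1, and the complexified functional vanishes at v exactly when T vanishes at
  -- both v and iv.
  have hinj : Function.Injective (k' x₀ : E →ₗ[ℂ] (Fin n → ℂ)) := by
    refine (injective_iff_map_eq_zero _).2 fun v hv => ?_
    have hh : h x₀ = 1 := by
      have := H.g_mul_h x₀ (Metric.mem_ball_self H.pos)
      rwa [H.g_center, one_mul] at this
    have h1 : ∀ i, complexifyFunctional (T i ∘L h x₀) v = 0 := fun i => congrFun hv i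
    simp only [complexifyFunctional_apply, hh] at h1
    refine hT v (fun i => ?_) fun i => ?_
    · simpa using congrArg Complex.re (h1 i)
    · simpa using congrArg Complex.im (h1 i)
  set e : E ≃L[ℂ] (Fin n → ℂ) := (LinearEquiv.ofInjectiveOfFinrankEq (k' x₀ : E →ₗ[ℂ] (Fin n → ℂ))
    hinj (by simp [hn])).toContinuousLinearEquiv with he
  have hex : k' x₀ ∈ Set.range ((↑) : (E ≃L[ℂ] (Fin n → ℂ)) → E →L[ℂ] (Fin n → ℂ)) :=
    ⟨e, by ext1 v; rfl⟩
  have hev := (hcont.continuousAt (Metric.ball_mem_nhds _ H.pos)).eventually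
    ((ContinuousLinearEquiv.isOpen (𝕜 := ℂ)).mem_nhds hex)
  obtain ⟨r', hr', hb⟩ := Metric.eventually_nhds_iff_ball.1
    (hev.and (Metric.ball_mem_nhds _ H.pos))
  refine isLocalDiffeomorphAt_comp_chart (𝕜 := ℂ) (s := Metric.ball x₀ r')
    (k := fun x i => potential h Φ (T i) x) Metric.isOpen_ball (Metric.mem_ball_self hr')
    (hcd.mono fun x hx => (hb x hx).2) one_ne_zero fun x hx => ?_
  obtain ⟨⟨e', he'⟩, hxr⟩ := hb x hx
  exact ⟨e', he' ▸ hder x hxr⟩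

end Coordinates

/-! ### From homogeneous functions back to a conic action -/

section Converse

/-- If `P = a Y + b Y j` with `Y = A'⁻¹ A` commutes with the complex structures, then so
does `Y`. -/
theorem eq_smul_add_smul_of_commute {V V' R : Type*} [AddCommGroup V] [Module ℝ V]
    [AddCommGroup V'] [Module ℝ V'] [AddCommGroup R] [Module ℝ R] {A : V →ₗ[ℝ] R}
    (A' : V' ≃ₗ[ℝ] R) {P : V →ₗ[ℝ] V'} {j : V →ₗ[ℝ] V} {j' : V' →ₗ[ℝ] V'}
    (hj : ∀ v, j (j v) = -v) (hj' : ∀ v, j' (j' v) = -v) (hP : ∀ v, P (j v) = j' (P v)) {a b : ℝ}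
    (hab : a * a + b * b ≠ 0) (hA : ∀ v, A' (P v) = a • A v + b • A (j v)) {x : V} {x' : V'}
    (hx : A x = A' x') : P x = a • x' + b • j' x' := by
  have hY : ∀ v, P v = a • A'.symm (A v) + b • A'.symm (A (j v)) := fun v => by
    rw [← A'.symm_apply_apply (P v), hA, map_add, map_smul, map_smul]
  have hx' : A'.symm (A x) = x' := by rw [hx, A'.symm_apply_apply]
  -- With Z = Yj - j'Y, comparing Pj with j'P gives aZ = b j'Z. Applying j' once more yields (a² +
  -- b²)Z = 0, here evaluated at x.
  have h1 : a • (A'.symm (A (j x)) - j' x') = b • j' (A'.symm (A (j x)) - j' x') := by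
    have h2 := hP x
    rw [hY, hY, hj, map_neg, map_neg, map_add, map_smul, map_smul, hx'] at h2
    rw [map_sub, hj', smul_sub, smul_sub, sub_eq_iff_eq_add]
    rw [smul_neg, ← sub_eq_add_neg, sub_eq_iff_eq_add] at h2
    rw [h2, smul_neg]
    abel
  have h3 : A'.symm (A (j x)) - j' x' = 0 := by
    have h4 := congrArg j' h1
    rw [map_smul, map_smul, hj'] at h4
    have h5 : (a * a + b * b) • (A'.symm (A (j x)) - j' x') = 0 := by
      rw [add_smul, mul_smul, h1, smul_comm, h4, mul_smul, smul_neg, smul_neg, neg_add_cancel]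
    exact (smul_eq_zero.1 h5).resolve_left hab
  rw [hY, hx', sub_eq_zero.1 h3]

variable {E : Type*} [NormedAddCommGroup E] [NormedSpace ℂ E] [FiniteDimensional ℂ E]
  {M : Type*} [TopologicalSpace M] [ChartedSpace E M]

variable {p q : M} {n : ℕ} {φ : LocalAction E M} {c : ℂ}

omit [FiniteDimensional ℂ E] in
theorem J_J (q : M) (v : TangentSpace 𝓘(ℝ, E) q) : J q (J q v) = -v := by
  have h : ∀ u : E, Complex.I • Complex.I • u = -u := fun u => by
    rw [smul_smul, Complex.I_mul_I, neg_one_smul]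
  exact h v

omit [FiniteDimensional ℂ E] in
theorem dR_clm_comp {F F' : Type*} [NormedAddCommGroup F] [NormedSpace ℝ F]
    [NormedAddCommGroup F'] [NormedSpace ℝ F'] (ℓ : F →L[ℝ] F') {f : M → F}
    (hf : MDifferentiableAt 𝓘(ℝ, E) 𝓘(ℝ, F) f q) (v : TangentSpace 𝓘(ℝ, E) q) :
    dR (fun x => ℓ (f x)) q v = ℓ (dR f q v) := by
  have h := HasMFDerivAt.comp q (ℓ.hasMFDerivAt (x := f q)) hf.hasMFDerivAt
  exact congrArg (fun T : TangentSpace 𝓘(ℝ, E) q →L[ℝ] F' => T v) h.mfderiv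

omit [FiniteDimensional ℂ E] in
/-- The derivative of the homogeneity equation. -/
theorem dR_homogeneous {f : M → ℂ} (hdom : (c, q) ∈ φ.domain)
    (hf : MDifferentiableAt 𝓘(ℂ, E) 𝓘(ℂ, ℂ) f q)
    (hf' : MDifferentiableAt 𝓘(ℂ, E) 𝓘(ℂ, ℂ) f (φ.act c q))
    (hhom : ∀ᶠ y in 𝓝 (c, q), f (φ.act y.1 y.2) = y.1 * f y.2) (v : TangentSpace 𝓘(ℝ, E) q) :
    dR f (φ.act c q) (mfderiv 𝓘(ℝ, E) 𝓘(ℝ, E) (φ.act c) q v) = c * dR f q v := by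
  have h1 := (hasMFDerivAt_restrictScalars (φ.mdifferentiableAt_act hdom)).mdifferentiableAt
  have h2 := (hasMFDerivAt_restrictScalars hf').mdifferentiableAt
  have h3 := (hasMFDerivAt_restrictScalars hf).mdifferentiableAt
  have h4 : HasMFDerivAt 𝓘(ℝ, E) 𝓘(ℝ, ℂ) (fun x => f (φ.act c x)) q
      (mfderiv 𝓘(ℝ, E) 𝓘(ℝ, ℂ) f (φ.act c q) ∘L mfderiv 𝓘(ℝ, E) 𝓘(ℝ, E) (φ.act c) q) :=
    HasMFDerivAt.comp q h2.hasMFDerivAt h1.hasMFDerivAt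
  have h5 := HasMFDerivAt.comp q
    ((ContinuousLinearMap.mul ℝ ℂ c).hasMFDerivAt (x := f q)) h3.hasMFDerivAt
  have h6 : (fun x => f (φ.act c x)) =ᶠ[𝓝 q] (ContinuousLinearMap.mul ℝ ℂ c) ∘ f :=
    (Continuous.prodMk_right c).tendsto q |>.eventually hhom
  have h7 := hasMFDerivAt_unique h4 (h5.congr_of_eventuallyEq h6)
  exact congrArg (fun T : TangentSpace 𝓘(ℝ, E) q →L[ℝ] ℂ => T v) h7

omit [FiniteDimensional ℂ E] in
theorem eventually_isLocalDiffeomorphAt {F : Type*} [NormedAddCommGroup F] [NormedSpace ℝ F]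
    {f : M → F} {k : WithTop ℕ∞} (hf : IsLocalDiffeomorphAt 𝓘(ℝ, E) 𝓘(ℝ, F) k f p) :
    ∀ᶠ q in 𝓝 p, IsLocalDiffeomorphAt 𝓘(ℝ, E) 𝓘(ℝ, F) k f q := by
  obtain ⟨Ψ, hp, h⟩ := hf
  filter_upwards [Ψ.open_source.mem_nhds hp] with q hq using ⟨Ψ, hq, h⟩

variable [IsManifold 𝓘(ℂ, E) ω M] {D : Connection E M}

omit [FiniteDimensional ℂ E] in
theorem mdifferentiableAt_dR_apply {f : M → ℝ} {X : Π x : M, TangentSpace 𝓘(ℝ, E) x}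
    (hf : ContMDiffAt 𝓘(ℝ, E) 𝓘(ℝ, ℝ) ∞ f q)
    (hX : MDifferentiableAt 𝓘(ℝ, E) 𝓘(ℝ, E).tangent
      (fun x => (⟨x, X x⟩ : TangentBundle 𝓘(ℝ, E) M)) q) :
    MDifferentiableAt 𝓘(ℝ, E) 𝓘(ℝ, ℝ) (fun y => dR f y (X y)) q := by
  have hq := mem_chart_source E q
  have hk := (contMDiffAt_iff_model hq).1 hf
  have hX' := (mdifferentiableAt_field_iff hq).1 hX
  have hk' : DifferentiableAt ℝ (fderiv ℝ (f ∘ (chartAt E q).symm)) (chartAt E q q) :=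
    (hk.fderiv_right (m := 1) (by norm_cast)).differentiableAt one_ne_zero
  have h1 := hasMFDerivAt_comp_chart hq (hk'.clm_apply hX').hasFDerivAt
  refine h1.mdifferentiableAt.congr_of_eventuallyEq ?_
  have h2 : ∀ᶠ x in 𝓝 (chartAt E q q), DifferentiableAt ℝ (f ∘ (chartAt E q).symm) x :=
    ((hk.of_le (m := 1) (by norm_cast)).eventually (by simp)).mono
      fun x hx => hx.differentiableAt one_ne_zero
  filter_upwards [((chartAt E q).continuousAt hq).eventually h2,
    (chartAt E q).open_source.mem_nhds hq] with y hy hys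
  have h3 := dR_of_eventuallyEq_comp_chart (f := f) hys hy.hasFDerivAt (by
    filter_upwards [(chartAt E q).open_source.mem_nhds hys] with x hx
    simp [(chartAt E q).left_inv hx])
  rw [h3, modelField_chart X hys]
  rfl

/-- The derivative of an affine function along a parallel field is locally constant. -/
theorem IsAffineOn.eventually_dR_eq [T2Space M] {f : M → ℝ} {U V : Set M}
    {X : Π x : M, TangentSpace 𝓘(ℝ, E) x} (hf : IsAffineOn D f V) (hV : IsOpen V) (hpV : p ∈ V)
    (hX : IsParallelFieldOn D X U) (hU : IsOpen U) (hpU : p ∈ U) :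
    ∀ᶠ q in 𝓝 p, dR f q (X q) = dR f p (X p) := by
  -- Affinity on V is tested against fields smooth on V, while X is only known to be smooth on U.
  obtain ⟨X', hX', hXX'⟩ := exists_smooth_extension hX.1 hU hpU
  have h1 : ∀ᶠ q in 𝓝 p, dR f q (X' q) = dR f p (X' p) := by
    refine eventually_eq_of_dR_eq_zero (E := E) (f := fun q => dR f q (X' q)) ?_
    filter_upwards [hV.mem_nhds hpV, hU.mem_nhds hpU, eventually_eventually_nhds.2 hXX']
      with q hqV hqU hq
    have hd := hX'.mdifferentiableAt isOpen_univ (Set.mem_univ q)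
    refine ⟨mdifferentiableAt_dR_apply ((hf.1 q hqV).contMDiffAt (hV.mem_nhds hqV)) hd,
      fun v => ?_⟩
    have h2 := hf.2 X' (hX'.mono (Set.subset_univ V)) q hqV v
    rw [D.congr_of_eventuallyEq hd (hX.1.mdifferentiableAt hU hqU) hq, hX.2 q hqU] at h2
    simpa using h2
  filter_upwards [h1, hXX'] with q hq hq'
  rw [← hq', hq, hXX'.self_of_nhds]

/-- An action is conic if there are functions with the properties (a) and (b). -/
theorem LocalAction.isConic_of_areConicFunctionsNear [T2Space M]
    (hφ : ∀ p : M, ∃ z w : Fin n → M → ℂ, AreConicFunctionsNear D φ z w p) : φ.IsConic D := by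
  intro U X hU hX p hp
  obtain ⟨z, w, H⟩ := hφ p
  obtain ⟨V, hV, hpV, hx, hy⟩ := H.affine.2
  set G : M → (Fin n → ℝ) × (Fin n → ℝ) :=
    fun q => (fun i => rePart z i q, fun j => rePart w j q) with hG
  set πx : Fin n → (Fin n → ℝ) × (Fin n → ℝ) →L[ℝ] ℝ := fun i =>
    ContinuousLinearMap.proj i ∘L ContinuousLinearMap.fst ℝ (Fin n → ℝ) (Fin n → ℝ) with hπx
  set πy : Fin n → (Fin n → ℝ) × (Fin n → ℝ) →L[ℝ] ℝ := fun i =>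
    ContinuousLinearMap.proj i ∘L ContinuousLinearMap.snd ℝ (Fin n → ℝ) (Fin n → ℝ) with hπy
  -- These properties will be used both at q and at φ_c(q), which also stays near p.
  have hgood : ∀ᶠ q in 𝓝 p, (∀ i, MDifferentiableAt 𝓘(ℂ, E) 𝓘(ℂ, ℂ) (z i) q) ∧
      (∀ i, MDifferentiableAt 𝓘(ℂ, E) 𝓘(ℂ, ℂ) (w i) q) ∧
      IsLocalDiffeomorphAt 𝓘(ℝ, E) 𝓘(ℝ, (Fin n → ℝ) × (Fin n → ℝ)) ∞ G q ∧
      dR G q (X q) = dR G p (X p) := by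
    have hGd := eventually_isLocalDiffeomorphAt H.affine.1
    filter_upwards [Filter.eventually_all.2 H.holomorphic_z,
      Filter.eventually_all.2 H.holomorphic_w, hGd,
      Filter.eventually_all.2 fun i => (hx i).eventually_dR_eq hV hpV hX hU hp,
      Filter.eventually_all.2 fun i => (hy i).eventually_dR_eq hV hpV hX hU hp]
      with q h1 h2 h3 h4 h5
    have hq := h3.mdifferentiableAt (by simp)
    have hp' := hGd.self_of_nhds.mdifferentiableAt (by simp)
    refine ⟨h1, h2, h3, Prod.ext (funext fun i => ?_) (funext fun i => ?_)⟩
    · exact (dR_clm_comp (πx i) hq _).symm.trans ((h4 i).trans (dR_clm_comp (πx i) hp' _))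
    · exact (dR_clm_comp (πy i) hq _).symm.trans ((h5 i).trans (dR_clm_comp (πy i) hp' _))
  filter_upwards [φ.eventually_mem_domain p,
    (continuous_snd.tendsto ((1 : ℂ), p)).eventually hgood, (φ.tendsto_act p).eventually hgood,
    Filter.eventually_all.2 fun i => eventually_eventually_nhds.2 (H.homogeneous_z i),
    Filter.eventually_all.2 fun i => eventually_eventually_nhds.2 (H.homogeneous_w i)]
    with ⟨c, q⟩ hdom ⟨hz, hw, hd, hXq⟩ ⟨hz', hw', hd', hXq'⟩ hhz hhw
  simp only at *
  have hre : ∀ {f : M → ℂ} {y : M}, MDifferentiableAt 𝓘(ℂ, E) 𝓘(ℂ, ℂ) f y →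
      ∀ v : TangentSpace 𝓘(ℝ, E) y, dR (fun x => (f x).re) y v = (dR f y v).re := fun hf v =>
    dR_clm_comp Complex.reCLM (hasMFDerivAt_restrictScalars hf).mdifferentiableAt v
  -- The term with Im df(v) is rewritten through Im df(v) = -Re df(Jv), so that only real parts,
  -- that is the affine coordinates, occur.
  have key : ∀ {f : M → ℂ}, MDifferentiableAt 𝓘(ℂ, E) 𝓘(ℂ, ℂ) f q →
      MDifferentiableAt 𝓘(ℂ, E) 𝓘(ℂ, ℂ) f (φ.act c q) →
      (∀ᶠ y in 𝓝 (c, q), f (φ.act y.1 y.2) = y.1 * f y.2) → ∀ v : TangentSpace 𝓘(ℝ, E) q,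
      dR (fun x => (f x).re) (φ.act c q) (mfderiv 𝓘(ℝ, E) 𝓘(ℝ, E) (φ.act c) q v)
        = c.re * dR (fun x => (f x).re) q v + c.im * dR (fun x => (f x).re) q (J q v) := by
    intro f hf hf' hhom v
    rw [hre hf', hre hf, hre hf, dR_homogeneous hdom hf hf' hhom, dR_J hf]
    simp [Complex.mul_re]
    ring
  have hGq := hd.mdifferentiableAt (by simp)
  have hGq' := hd'.mdifferentiableAt (by simp)
  have hlin : ∀ v : TangentSpace 𝓘(ℝ, E) q,
      dR G (φ.act c q) (mfderiv 𝓘(ℝ, E) 𝓘(ℝ, E) (φ.act c) q v)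
        = c.re • dR G q v + c.im • dR G q (J q v) := by
    intro v
    refine Prod.ext (funext fun i => ?_) (funext fun i => ?_)
    · have h1 := key (hz i) (hz' i) (hhz i) v
      exact (dR_clm_comp (πx i) hGq' _).symm.trans (h1.trans (congrArg₂ (fun s t : ℝ =>
        c.re * s + c.im * t) (dR_clm_comp (πx i) hGq _) (dR_clm_comp (πx i) hGq _)))
    · have h1 := key (hw i) (hw' i) (hhw i) v
      exact (dR_clm_comp (πy i) hGq' _).symm.trans (h1.trans (congrArg₂ (fun s t : ℝ =>
        c.re * s + c.im * t) (dR_clm_comp (πy i) hGq _) (dR_clm_comp (πy i) hGq _)))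
  rw [Complex.norm_mul_cos_arg, Complex.norm_mul_sin_arg]
  have hc : c.re * c.re + c.im * c.im ≠ 0 := by
    have := Complex.normSq_pos.2 (φ.ne_zero c q hdom)
    rw [Complex.normSq_apply] at this
    exact this.ne'
  let A' : TangentSpace 𝓘(ℝ, E) (φ.act c q) ≃ₗ[ℝ] (Fin n → ℝ) × (Fin n → ℝ) :=
    (hd'.mfderivToContinuousLinearEquiv (by simp)).toLinearEquiv
  let A : TangentSpace 𝓘(ℝ, E) q →ₗ[ℝ] (Fin n → ℝ) × (Fin n → ℝ) := (dR G q).toLinearMap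
  let P : TangentSpace 𝓘(ℝ, E) q →ₗ[ℝ] TangentSpace 𝓘(ℝ, E) (φ.act c q) :=
    (mfderiv 𝓘(ℝ, E) 𝓘(ℝ, E) (φ.act c) q).toLinearMap
  let j : TangentSpace 𝓘(ℝ, E) q →ₗ[ℝ] TangentSpace 𝓘(ℝ, E) q := (J q).toLinearMap
  let j' : TangentSpace 𝓘(ℝ, E) (φ.act c q) →ₗ[ℝ] TangentSpace 𝓘(ℝ, E) (φ.act c q) :=
    (J (φ.act c q)).toLinearMap
  exact eq_smul_add_smul_of_commute (A := A) (P := P) (j := j) (j' := j') A' (J_J q) (J_J _)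
    (mfderiv_J (φ.mdifferentiableAt_act hdom)) hc hlin (hXq.trans hXq'.symm)

end Converse

end SpecialGeometry

/-! ### Assembly of the three cases -/

theorem mainTheorem7 {E : Type*} [NormedAddCommGroup E] [NormedSpace ℂ E] [FiniteDimensional ℂ E]
    {M : Type*} [TopologicalSpace M] [T2Space M] [ChartedSpace E M] [IsManifold 𝓘(ℂ, E) ω M]
    (D : Connection E M) (hsmooth : D.ContMDiffCovariantDerivative ∞)
    (hflat : IsFlat D) (htorsion : D.torsion = 0) :
    -- (i) the complex case
    (IsConicComplex D ↔
      ∃ φ : LocalAction E M, ∀ p : M, ∃ z w : Fin (Module.finrank ℂ E) → M → ℂ,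
        AreConicFunctionsNear D φ z w p) ∧
    -- (ii) the symplectic case
    (∀ α : BilinField E M, IsSymplectic α → IsParallelForm D α →
      (IsConicSymplectic D α ↔
        ∃ φ : LocalAction E M, ∀ p : M, ∃ z w : Fin (Module.finrank ℂ E) → M → ℂ,
          AreConicFunctionsNear D φ z w p) ∧
      (IsConicSymplectic D α →
        ∀ φ : LocalAction E M, φ.IsConic D →
          ∀ p : M, ∃ z w : Fin (Module.finrank ℂ E) → M → ℂ,
            AreConicFunctionsNear D φ z w p ∧
            AreRealSpecialNear D α (rePart z) (rePart w) p)) ∧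
    -- (iii) the Kähler case
    (∀ α : BilinField E M, IsSymplectic α → IsParallelForm D α → IsJInvariant α →
      (IsConicKaehler D α ↔
        ∃ φ : LocalAction E M, ∀ p : M, ∃ z w : Fin (Module.finrank ℂ E) → M → ℂ,
          AreConicFunctionsNear D φ z w p) ∧
      (IsConicKaehler D α →
        ∀ φ : LocalAction E M, φ.IsConic D →
          ∀ p : M, ∃ z w : Fin (Module.finrank ℂ E) → M → ℂ,
            AreConicFunctionsNear D φ z w p ∧
            AreConjugatePairNear D α z w p)) := by
  have hrank : Module.finrank ℝ E = 2 * Module.finrank ℂ E := finrank_real_of_complex E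
  have hback : ∀ φ : LocalAction E M, (∀ p : M, ∃ z w : Fin (Module.finrank ℂ E) → M → ℂ,
      AreConicFunctionsNear D φ z w p) → IsConicComplex D := fun φ hφ =>
    ⟨φ, LocalAction.isConic_of_areConicFunctionsNear hφ⟩
  have hforth : IsConicComplex D → ∃ φ : LocalAction E M, ∀ p : M,
      ∃ z w : Fin (Module.finrank ℂ E) → M → ℂ, AreConicFunctionsNear D φ z w p := by
    rintro ⟨φ, hφ⟩
    refine ⟨φ, fun p => ?_⟩
    obtain ⟨g, h, r, H, hP⟩ := exists_hasPotentials hsmooth hflat htorsion hφ p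
    -- Without a form to normalize, any real linear isomorphism from E to ℝⁿ × ℝⁿ serves.
    exact ⟨_, _, areConicFunctionsNear_chartPotential hφ htorsion H hP
      (LinearEquiv.ofFinrankEq E _ (by rw [hrank]; simp [two_mul]))⟩
  have hequiv : IsConicComplex D ↔ ∃ φ : LocalAction E M, ∀ p : M,
      ∃ z w : Fin (Module.finrank ℂ E) → M → ℂ, AreConicFunctionsNear D φ z w p :=
    ⟨hforth, fun ⟨φ, hφ⟩ => hback φ hφ⟩
  -- The equivalences in the symplectic and Kähler cases reduce to the complex case, since the
  -- conditions on the form are given; the content lies in the choice of L.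
  refine ⟨hequiv, fun α hα hpar => ⟨⟨fun h => hequiv.1 h.1, fun h => ⟨hequiv.2 h, hα, hpar⟩⟩,
    fun _ φ hφ p => ?_⟩, fun α hα hpar hJ => ⟨⟨fun h => hequiv.1 h.1.1,
      fun h => ⟨⟨hequiv.2 h, hα, hpar⟩, hJ⟩⟩, fun _ φ hφ p => ?_⟩⟩
  · obtain ⟨g, h, r, H, hP⟩ := exists_hasPotentials hsmooth hflat htorsion hφ p
    obtain ⟨L, hL⟩ := exists_symplectic_coordinates (modelForm_isAlt hα p p)
      (modelForm_nondegenerate hα (mem_chart_source E p)) hrank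
    exact ⟨_, _, areConicFunctionsNear_chartPotential hφ htorsion H hP L,
      areRealSpecialNear_chartPotential hα hpar hφ htorsion H hP hL⟩
  · obtain ⟨g, h, r, H, hP⟩ := exists_hasPotentials hsmooth hflat htorsion hφ p
    -- Applied with K = multiplication by i in the chart at p; the two injectivity statements make z
    -- and w separately holomorphic coordinates.
    obtain ⟨L, hL, h1, h2⟩ := exists_hermitian_coordinates (modelForm_isAlt hα p p)
      (modelForm_nondegenerate hα (mem_chart_source E p)) hrank
      ((Complex.I • (LinearMap.id : E →ₗ[ℂ] E)).restrictScalars ℝ)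
      (fun v => by simp [smul_smul]) (modelForm_smul_I hJ (mem_chart_source E p))
    exact ⟨_, _, areConicFunctionsNear_chartPotential hφ htorsion H hP L,
      areHolomorphicCoordinatesNear_chartPotential H hP rfl _ fun v hv hv' =>
        h1 v (funext hv) (funext hv'),
      areHolomorphicCoordinatesNear_chartPotential H hP rfl _ fun v hv hv' =>
        h2 v (funext hv) (funext hv'),
      areRealSpecialNear_chartPotential hα hpar hφ htorsion H hP hL⟩
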